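/- Let $\Omega=\{x\in\mathbb R^2:|x|<1\}$ be the open unit disk and let $\sigma_1,\sigma_2>0$ be constants with $\sigma_1\neq\sigma_2$. For an open disk $D$ with $\overline D\subset\Omega$ and $f\in H^{1/2}(\partial\Omega)$, let $u\in H^1(\Omega)$ be the weak solution of $$\operatorname{div}\big((\sigma_1+(\sigma_2-\sigma_1)\chi_D)\nabla u\big)=0\ \text{ in }\Omega,\qquad u=f\ \text{ on }\partial\Omega,$$ and let $\Lambda_D(f)=\sigma_1\,\partial_n u|_{\partial\Omega}\in H^{-1/2}(\partial\Omega)$, that is, $\langle\Lambda_D(f),w|_{\partial\Omega}\rangle=\int_\Omega(\sigma_1+(\sigma_2-\sigma_1)\chi_D)\nabla u\cdot\nabla w\,dx$ for all $w\in H^1(\Omega)$. **Theorem 2.1.** Let $D_1$ be the open disk of radius $R_1\in(0,1)$ centred at the origin, and take the single boundary measurement $f(\theta)=\cos\theta$. If $D_2$ is any open disk of positive radius with $\overline{D_2}\subset\Omega$ and $\Lambda_{D_2}(f)=\Lambda_{D_1}(f)$, then $D_2=D_1$. -/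

import Mathlib

open MeasureTheory Filter Topology
open scoped ContDiff ENNReal

noncomputable section

namespace DiskTomography

/-! The plane `ℝ²` is identified with `ℂ`, regarded as a real inner product space with Lebesgue
measure; `inner ℝ z w` is the Euclidean inner product and `gradient` the Euclidean gradient. -/

/-- The domain: the open unit disk. -/
def Ω : Set ℂ := Metric.ball 0 1

/-- Lebesgue measure on the unit disk. -/
def volΩ : Measure ℂ := volume.restrict Ω

instance factTwoPiPos : Fact (0 < 2 * Real.pi) := ⟨Real.two_pi_pos⟩

/-- The unit circle `∂Ω`, parametrized by the angle `θ ∈ ℝ / 2πℤ`. -/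
abbrev Angles : Type := AddCircle (2 * Real.pi)

/-- The point `e^{iθ}` of `∂Ω`. -/
def bdryPoint (θ : Angles) : ℂ := (AddCircle.toCircle θ : ℂ)

/-- The (normalized) arc length measure on the circle. -/
abbrev arc : Measure Angles := AddCircle.haarAddCircle

/-- The complex Fourier coefficient `c_n(f) = (1/2π) ∫ f(θ) e^{-inθ} dθ` of a real function. -/
def coeff (f : Angles → ℝ) (n : ℤ) : ℂ := fourierCoeff (fun θ => (f θ : ℂ)) n

theorem coeff_add {f g : Angles → ℝ} (hf : MemLp f 2 arc) (hg : MemLp g 2 arc) (n : ℤ) :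
    coeff (f + g) n = coeff f n + coeff g n := by
  have h1 : Integrable (fun θ => (f θ : ℂ)) arc := (hf.integrable (by norm_num)).ofReal
  have h2 : Integrable (fun θ => (g θ : ℂ)) arc := (hg.integrable (by norm_num)).ofReal
  have h := congrFun (fourierCoeff.add h1 h2) n
  simp only [Pi.add_apply] at h
  rw [coeff, coeff, coeff, ← h]
  congr 1
  funext θ
  simp

theorem coeff_smul (a : ℝ) (f : Angles → ℝ) (n : ℤ) :
    coeff (a • f) n = (a : ℂ) * coeff f n := by
  rw [coeff, coeff, ← fourierCoeff.const_mul]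
  congr 1
  funext θ
  simp

/-- The space `H^{1/2}(S¹)` of real square integrable functions on the circle with
`∑ |n| |c_n(f)|² < ∞` (as functions; two of them that agree almost everywhere are not
identified). -/
def HHalf : Submodule ℝ (Angles → ℝ) where
  carrier := {f | MemLp f 2 arc ∧ Summable fun n : ℤ => |(n : ℝ)| * ‖coeff f n‖ ^ 2}
  zero_mem' := by
    refine ⟨MemLp.zero, ?_⟩
    have h : ∀ n : ℤ, coeff 0 n = 0 := fun n => by simpa using coeff_smul 0 0 n
    simp [h, summable_zero]
  add_mem' := by
    rintro f g ⟨hf, hf'⟩ ⟨hg, hg'⟩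
    refine ⟨hf.add hg, ?_⟩
    refine Summable.of_nonneg_of_le (fun n => by positivity) (fun n => ?_)
      ((hf'.mul_left 2).add (hg'.mul_left 2))
    rw [coeff_add hf hg]
    have h1 := norm_add_le (coeff f n) (coeff g n)
    have h2 : ‖coeff f n + coeff g n‖ ^ 2 ≤ 2 * ‖coeff f n‖ ^ 2 + 2 * ‖coeff g n‖ ^ 2 := by
      nlinarith [norm_nonneg (coeff f n + coeff g n), sq_nonneg (‖coeff f n‖ - ‖coeff g n‖)]
    nlinarith [mul_le_mul_of_nonneg_left h2 (abs_nonneg (n : ℝ))]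
  smul_mem' := by
    rintro a f ⟨hf, hf'⟩
    refine ⟨hf.const_smul a, ?_⟩
    refine (hf'.mul_left (|a| ^ 2)).congr (fun n => ?_)
    rw [coeff_smul, norm_mul, Complex.norm_real, Real.norm_eq_abs]
    ring

/-- The square of the norm of `H^{1/2}(S¹)`. -/
def normSqHHalf (φ : HHalf) : ℝ := ∑' n : ℤ, (1 + |(n : ℝ)|) * ‖coeff φ.1 n‖ ^ 2

/-- The space `H^{-1/2}(S¹)`: the bounded linear functionals on `H^{1/2}(S¹)`. -/
structure HNegHalf extends HHalf →ₗ[ℝ] ℝ where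
  bounded : ∃ C : ℝ, ∀ φ : HHalf, (toFun φ) ^ 2 ≤ C * normSqHHalf φ

/-- Test functions `C_c^∞(Ω)`. -/
def IsTest (φ : ℂ → ℝ) : Prop :=
  ContDiff ℝ ∞ φ ∧ HasCompactSupport φ ∧ tsupport φ ⊆ Ω

/-- `u ∈ H¹(Ω)` with weak gradient `G ∈ L²(Ω; ℝ²)`: for all test functions `φ` and all
directions `v` one has `∫_Ω u ∂_v φ = - ∫_Ω (G · v) φ`. -/
def IsH1 (u : ℂ → ℝ) (G : ℂ → ℂ) : Prop :=
  MemLp u 2 volΩ ∧ MemLp G 2 volΩ ∧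
    ∀ φ : ℂ → ℝ, IsTest φ → ∀ v : ℂ,
      ∫ x, u x * fderiv ℝ φ x v ∂volΩ = -∫ x, inner ℝ (G x) v * φ x ∂volΩ

/-- `f` is the trace on `∂Ω` of the function `u ∈ H¹(Ω)` with weak gradient `G`. The trace operator
`H¹(Ω) → L²(∂Ω)` is the continuous extension of the restriction to `∂Ω` of functions that are
smooth up to the boundary: there are such functions `v k` that tend to `u` in `H¹(Ω)` and whose
restrictions to `∂Ω` tend to `f` in `L²(∂Ω)`. -/
def HasTrace (u : ℂ → ℝ) (G : ℂ → ℂ) (f : Angles → ℝ) : Prop :=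
  ∃ v : ℕ → ℂ → ℝ, (∀ k, ContDiff ℝ ∞ (v k)) ∧
    Tendsto (fun k => eLpNorm (fun x => v k x - u x) 2 volΩ) atTop (𝓝 0) ∧
    Tendsto (fun k => eLpNorm (fun x => gradient (v k) x - G x) 2 volΩ) atTop (𝓝 0) ∧
    Tendsto (fun k => eLpNorm (fun θ => v k (bdryPoint θ) - f θ) 2 arc) atTop (𝓝 0)

open Classical in
/-- The conductivity `σ₁ + (σ₂ - σ₁) χ_D`. -/
def conductivity (σ₁ σ₂ : ℝ) (D : Set ℂ) (x : ℂ) : ℝ :=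
  σ₁ + (σ₂ - σ₁) * (if x ∈ D then 1 else 0)

/-- `u` (with weak gradient `G`) is the weak solution in `H¹(Ω)` of the Dirichlet problem
`div ((σ₁ + (σ₂ - σ₁) χ_D) ∇u) = 0` in `Ω`, `u = f` on `∂Ω`. -/
def SolvesDirichlet (σ₁ σ₂ : ℝ) (D : Set ℂ) (f : HHalf) (u : ℂ → ℝ) (G : ℂ → ℂ) : Prop :=
  IsH1 u G ∧ HasTrace u G f.1 ∧
    ∀ φ : ℂ → ℝ, IsTest φ →
      ∫ x, conductivity σ₁ σ₂ D x * inner ℝ (G x) (gradient φ x) ∂volΩ = 0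

/-- The functional `g ∈ H^{-1/2}(∂Ω)` is the conormal derivative `σ₁ ∂_n u` on `∂Ω` of a solution
`u` (with weak gradient `G`): by Green's formula, `⟨g, φ⟩ = ∫_Ω σ ∇u · ∇w` for all
`φ ∈ H^{1/2}(∂Ω)` and all extensions `w ∈ H¹(Ω)` of `φ`. -/
def HasFlux (σ₁ σ₂ : ℝ) (D : Set ℂ) (G : ℂ → ℂ) (g : HNegHalf) : Prop :=
  ∀ (φ : HHalf) (w : ℂ → ℝ) (W : ℂ → ℂ), IsH1 w W → HasTrace w W φ.1 →
    g.toLinearMap φ = ∫ x, conductivity σ₁ σ₂ D x * inner ℝ (G x) (W x) ∂volΩ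

/-- The graph of the Dirichlet-to-Neumann map `Λ_D : H^{1/2}(∂Ω) → H^{-1/2}(∂Ω)`: the relation
`g = Λ_D(f)`, that is, `(f, g)` is the Cauchy pair `(u, σ₁ ∂_n u)` on `∂Ω` of the solution `u` of
the Dirichlet problem with datum `f`. -/
def IsDirichletToNeumann (σ₁ σ₂ : ℝ) (D : Set ℂ) (f : HHalf) (g : HNegHalf) : Prop :=
  ∃ (u : ℂ → ℝ) (G : ℂ → ℂ), SolvesDirichlet σ₁ σ₂ D f u G ∧ HasFlux σ₁ σ₂ D G g

/-- The function `θ ↦ cos θ` on the circle. -/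
def cosFun (θ : Angles) : ℝ := Real.Angle.cos θ

theorem cosFun_coe (t : ℝ) : cosFun (t : Angles) = Real.cos t := rfl

theorem continuous_cosFun : Continuous cosFun := Real.Angle.continuous_cos

theorem cosFun_eq (θ : Angles) :
    (cosFun θ : ℂ) = (1 / 2 : ℂ) * fourier 1 θ + (1 / 2 : ℂ) * fourier (-1) θ := by
  induction θ using QuotientAddGroup.induction_on with
  | H t =>
    have hp : (Real.pi : ℂ) ≠ 0 := by exact_mod_cast Real.pi_ne_zero
    have e1 : (2 * (Real.pi : ℂ) * Complex.I * ((1 : ℤ) : ℂ) * (t : ℂ) / ((2 * Real.pi : ℝ) : ℂ))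
        = t * Complex.I := by
      push_cast; field_simp
    have e2 : (2 * (Real.pi : ℂ) * Complex.I * ((-1 : ℤ) : ℂ) * (t : ℂ) / ((2 * Real.pi : ℝ) : ℂ))
        = -t * Complex.I := by
      push_cast; field_simp
    have h1 := fourier_coe_apply (T := 2 * Real.pi) (n := 1) (x := t)
    have h2 := fourier_coe_apply (T := 2 * Real.pi) (n := -1) (x := t)
    rw [e1] at h1
    rw [e2] at h2
    change ((Real.cos t : ℝ) : ℂ) = _ * fourier 1 (t : Angles) + _ * fourier (-1) (t : Angles)
    rw [h1, h2, Complex.ofReal_cos, Complex.cos]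
    ring

theorem memLp_cosFun : MemLp cosFun 2 arc :=
  (continuous_cosFun.memLp_top_of_hasCompactSupport
    (HasCompactSupport.of_compactSpace _) arc).mono_exponent le_top

theorem coeff_cosFun (n : ℤ) (h1 : n ≠ 1) (h2 : n ≠ -1) : coeff cosFun n = 0 := by
  have hi : ∀ m : ℤ, Integrable (fun θ : Angles => (1 / 2 : ℂ) * fourier m θ) arc := fun m =>
    (continuous_const.mul (fourier m).continuous).integrable_of_hasCompactSupport
      (HasCompactSupport.of_compactSpace _)
  have h := congrFun (fourierCoeff.add (hi 1) (hi (-1))) n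
  have e : (fun θ => (cosFun θ : ℂ)) = (fun θ : Angles => (1 / 2 : ℂ) * fourier 1 θ) +
      (fun θ : Angles => (1 / 2 : ℂ) * fourier (-1) θ) := funext cosFun_eq
  rw [coeff, e, h, Pi.add_apply, fourierCoeff.const_mul, fourierCoeff.const_mul,
    fourierCoeff_fourier, fourierCoeff_fourier]
  simp [h1, h2]

/-- The measurement `f(θ) = cos θ` as an element of `H^{1/2}(S¹)`. -/
def cosData : HHalf :=
  ⟨cosFun, memLp_cosFun, summable_of_ne_finset_zero (s := {1, -1}) (fun n hn => by
    simp only [Finset.mem_insert, Finset.mem_singleton, not_or] at hn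
    simp [coeff_cosFun n hn.1 hn.2])⟩

end DiskTomography

end

/-!
The proof rests on the symmetry of the Dirichlet-to-Neumann map and on explicit solutions of the
transmission problem; neither interior regularity nor unique continuation is needed.

Write `k = σ₂ / σ₁`, `α = (1 + k) / 2`, `β = (1 - k) / 2`, `ζ = z - c`. For `n ≥ 1` and `b ∈ ℂ`
the function `w` equal to `Re (b ζⁿ)` in the disk `|ζ| < R` and to `Re (α b ζⁿ + β b̄ R²ⁿ ζ⁻ⁿ)`
outside satisfies `div (σ ∇w) = 0` for the conductivity `σ` of that disk (`transVal`, with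
gradient `transFld`). Green's formula `∫ σ ∇u · ∇w = σ₁ ∫ u ∂ₙw` then evaluates the flux `Λ(cos)`
of the second disk on the boundary values of `w` without knowing the weak solution `u`
(`HasTrace.integral_conductivity_transFld`). For the first, centred, disk the weak solution is a
multiple of the explicit one with `n = 1` by the energy argument (`ae_eq_transFld_centred`), so
that `Λ(cos)` is `σ₁ (α - β R₁²) / (α + β R₁²)` times the cosine (`flux_centred`). Equality of the
two fluxes on `w` compares the first cosine coefficients of `∂ₙw` and of `w`, which the mean value
property computes (`integral_outerDeriv`). The outcome is `moment_identity`: for `n = 1` it says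
`R₁² = R₂²`, and for `n = 2`, `b = c̄` it says `|c|² = 0`; in both cases a factor `1 - k²` has to
be cancelled, which is where `σ₁ ≠ σ₂` enters.

Green's formula is obtained without integrating over the pieces of `Ω`. The flux `σ ∇w` is `-i σ₁
∇s` for a Lipschitz stream function `s` of the same form as `w` (`conductivity_mul_transFld`).
Both `w` and `s` are limits of functions that are smooth on the whole plane, obtained by smoothing
a single maximum (`transApprox`, `tendsto_formula`), and for smooth functions Green's formula is
the divergence theorem in polar coordinates on the unit disk (`integral_inner_rot_gradient`). The
same approximations provide the trace and the weak gradient of `w` (`hasTrace_transVal`,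
`HasTrace.isH1`).
-/

noncomputable section

namespace DiskTomography

/-! ### Convergence in `L²` -/

theorem tendsto_integral_inner {α E : Type*} [MeasurableSpace α] {μ : Measure α}
    [NormedAddCommGroup E] [InnerProductSpace ℝ E] {F G : ℕ → α → E} {f g : α → E}
    (hF : ∀ k, MemLp (F k) 2 μ) (hG : ∀ k, MemLp (G k) 2 μ) (hf : MemLp f 2 μ) (hg : MemLp g 2 μ)
    (hFf : Tendsto (fun k => eLpNorm (fun x => F k x - f x) 2 μ) atTop (𝓝 0))
    (hGg : Tendsto (fun k => eLpNorm (fun x => G k x - g x) 2 μ) atTop (𝓝 0)) :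
    Tendsto (fun k => ∫ x, inner ℝ (F k x) (G k x) ∂μ) atTop (𝓝 (∫ x, inner ℝ (f x) (g x) ∂μ)) := by
  have h1 := (Lp.tendsto_Lp_iff_tendsto_eLpNorm'' F hF f hf).2 hFf
  have h2 := (Lp.tendsto_Lp_iff_tendsto_eLpNorm'' G hG g hg).2 hGg
  have e : ∀ {u v : α → E} (hu : MemLp u 2 μ) (hv : MemLp v 2 μ),
      inner ℝ (hu.toLp u) (hv.toLp v) = ∫ x, inner ℝ (u x) (v x) ∂μ := by
    intro u v hu hv
    rw [L2.inner_def]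
    refine integral_congr_ae ?_
    filter_upwards [hu.coeFn_toLp, hv.coeFn_toLp] with x h1 h2
    rw [h1, h2]
  have h3 := h1.inner (𝕜 := ℝ) h2
  simpa only [e] using h3

theorem tendsto_eLpNorm_of_dominated {α E : Type*} [MeasurableSpace α] {μ : Measure α}
    [IsFiniteMeasure μ] [NormedAddCommGroup E] {F : ℕ → α → E} {f : α → E} (C : ℝ)
    (hF : ∀ k, AEStronglyMeasurable (F k) μ) (hf : AEStronglyMeasurable f μ)
    (hb : ∀ k, ∀ᵐ x ∂μ, ‖F k x‖ ≤ C)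
    (hlim : ∀ᵐ x ∂μ, Tendsto (fun k => F k x) atTop (𝓝 (f x))) :
    Tendsto (fun k => eLpNorm (fun x => F k x - f x) 2 μ) atTop (𝓝 0) := by
  have hfb : ∀ᵐ x ∂μ, ‖f x‖ ≤ C := by
    filter_upwards [hlim, ae_all_iff.2 hb] with x hx hx'
    exact le_of_tendsto hx.norm (Eventually.of_forall hx')
  have h0 : Tendsto (fun k => ∫⁻ x, ‖F k x - f x‖ₑ ^ (2 : ℝ) ∂μ) atTop (𝓝 (∫⁻ _, 0 ∂μ)) := by
    refine tendsto_lintegral_of_dominated_convergence' (fun _ => ENNReal.ofReal (C + C) ^ (2 : ℝ))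
      (fun k => (((hF k).sub hf).enorm.pow_const _)) (fun k => ?_) ?_ ?_
    · filter_upwards [hb k, hfb] with x h1 h2
      refine ENNReal.rpow_le_rpow ?_ (by norm_num)
      rw [← ofReal_norm]
      exact ENNReal.ofReal_le_ofReal ((norm_sub_le _ _).trans (add_le_add h1 h2))
    · rw [lintegral_const]
      exact ENNReal.mul_ne_top (ENNReal.rpow_ne_top_of_nonneg (by norm_num) ENNReal.ofReal_ne_top)
        (measure_ne_top _ _)
    · filter_upwards [hlim] with x hx
      have h := (hx.sub_const (f x)).enorm.ennrpow_const 2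
      simpa using h
  have h1 := h0.ennrpow_const (1 / 2)
  simp only [lintegral_zero] at h1
  rw [ENNReal.zero_rpow_of_pos (by norm_num)] at h1
  refine h1.congr fun k => ?_
  rw [eLpNorm_eq_lintegral_rpow_enorm_toReal (by norm_num) (by norm_num)]
  norm_num

/-! ### The unit circle and polar coordinates -/

theorem bdryPoint_coe (t : ℝ) : bdryPoint (t : Angles) = Complex.exp (t * Complex.I) := by
  have hp : Real.pi ≠ 0 := Real.pi_ne_zero
  rw [bdryPoint, AddCircle.toCircle_apply_mk, Circle.coe_exp]
  congr 2
  field_simp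

theorem continuous_bdryPoint : Continuous bdryPoint :=
  continuous_subtype_val.comp AddCircle.continuous_toCircle

theorem norm_bdryPoint (θ : Angles) : ‖bdryPoint θ‖ = 1 := Circle.norm_coe _

theorem integral_arc {E : Type*} [NormedAddCommGroup E] [NormedSpace ℝ E] (f : Angles → E) (a : ℝ) :
    ∫ t in a..a + 2 * Real.pi, f (t : Angles) = (2 * Real.pi) • ∫ θ, f θ ∂arc := by
  rw [AddCircle.intervalIntegral_preimage, AddCircle.volume_eq_smul_haarAddCircle,
    integral_smul_measure, ENNReal.toReal_ofReal Real.two_pi_pos.le]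

instance : IsFiniteMeasure volΩ := by
  refine ⟨?_⟩
  rw [volΩ, Measure.restrict_apply_univ]
  exact measure_ball_lt_top

theorem fderiv_eq_inner_gradient (w : ℂ → ℝ) (x y : ℂ) :
    fderiv ℝ w x y = inner ℝ (gradient w x) y := by simp [gradient]

theorem continuous_gradient {w : ℂ → ℝ} (hw : ContDiff ℝ ∞ w) : Continuous (gradient w) :=
  (InnerProductSpace.toDual ℝ ℂ).symm.continuous.comp (hw.continuous_fderiv (by simp))

/-- The real Jacobian `∂₁v ∂₂s - ∂₂v ∂₁s` is the pairing of `∇v` with the rotated gradient of `s`;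
by the chain rule for `(r, θ) ↦ r e^{iθ}` its product with `r` is `∂ᵣV ∂_θS - ∂_θV ∂ᵣS`. -/
theorem integral_inner_rot_gradient {v s : ℂ → ℝ} (hv : ContDiff ℝ ∞ v) (hs : ContDiff ℝ ∞ s) :
    ∫ x, inner ℝ (gradient v x) (-Complex.I * gradient s x) ∂volΩ =
      (2 * Real.pi) * ∫ θ, v (bdryPoint θ) *
        inner ℝ (gradient s (bdryPoint θ)) (Complex.I * bdryPoint θ) ∂arc := by
  set Φ : ℝ × ℝ → ℂ := fun p => (p.1 : ℂ) * Complex.exp (p.2 * Complex.I) with hΦ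
  have hΦc : ContDiff ℝ ∞ Φ := by
    refine (Complex.ofRealCLM.contDiff.comp contDiff_fst).mul ?_
    exact ((Complex.ofRealCLM.contDiff.comp contDiff_snd).mul contDiff_const).cexp
  have hof : ∀ x : ℝ, HasDerivAt (fun y : ℝ => (y : ℂ)) 1 x := fun x =>
    (hasDerivAt_id x).ofReal_comp
  have hΦr : ∀ p : ℝ × ℝ, fderiv ℝ Φ p (1, 0) = Complex.exp (p.2 * Complex.I) := by
    rintro ⟨r, t⟩
    have h1 : HasFDerivAt Φ (fderiv ℝ Φ (r, t)) (r, t) :=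
      (hΦc.differentiable (by simp) _).hasFDerivAt
    have h2 : HasDerivAt (fun r : ℝ => ((r, t) : ℝ × ℝ)) (1, 0) r :=
      (hasDerivAt_id r).prodMk (hasDerivAt_const r t)
    have h3 : HasDerivAt (fun r : ℝ => Φ (r, t)) (1 * Complex.exp (t * Complex.I)) r :=
      (hof r).mul_const (Complex.exp (t * Complex.I))
    have h4 : HasDerivAt (fun r : ℝ => Φ (r, t)) (fderiv ℝ Φ (r, t) (1, 0)) r :=
      HasFDerivAt.comp_hasDerivAt (f := fun r : ℝ => ((r, t) : ℝ × ℝ)) r h1 h2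
    simpa using h4.unique h3
  have hΦt : ∀ p : ℝ × ℝ, fderiv ℝ Φ p (0, 1) = Complex.I * Φ p := by
    rintro ⟨r, t⟩
    have h1 : HasFDerivAt Φ (fderiv ℝ Φ (r, t)) (r, t) :=
      (hΦc.differentiable (by simp) _).hasFDerivAt
    have h2 : HasDerivAt (fun t : ℝ => ((r, t) : ℝ × ℝ)) (0, 1) t :=
      (hasDerivAt_const t r).prodMk (hasDerivAt_id t)
    have h3 : HasDerivAt (fun t : ℝ => Φ (r, t)) (r * (Complex.exp (t * Complex.I) *
        (1 * Complex.I))) t :=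
      (((hof t).mul_const Complex.I).cexp).const_mul (r : ℂ)
    have h4 := (h1.comp_hasDerivAt t h2).unique h3
    rw [h4, hΦ]
    ring
  set V : ℝ × ℝ → ℝ := v ∘ Φ with hV
  set S : ℝ × ℝ → ℝ := s ∘ Φ with hS
  have hVc : ContDiff ℝ ∞ V := hv.comp hΦc
  have hSc : ContDiff ℝ ∞ S := hs.comp hΦc
  have chain : ∀ {w : ℂ → ℝ}, ContDiff ℝ ∞ w → ∀ p q,
      fderiv ℝ (w ∘ Φ) p q = inner ℝ (gradient w (Φ p)) (fderiv ℝ Φ p q) := by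
    intro w hw p q
    rw [fderiv_comp p (hw.differentiable (by simp) _) (hΦc.differentiable (by simp) _),
      ← fderiv_eq_inner_gradient]
    rfl
  -- Divergence theorem on the rectangle for the field `(V ∂_θS, -V ∂ᵣS)`.
  have hS' : ContDiff ℝ ∞ (fderiv ℝ S) := hSc.fderiv_right (by simp)
  have hdir : ∀ q : ℝ × ℝ, ContDiff ℝ ∞ (fun p => fderiv ℝ S p q) := fun q =>
    hS'.clm_apply contDiff_const
  set f : ℝ × ℝ → ℝ := fun p => V p * fderiv ℝ S p (0, 1) with hf
  set g : ℝ × ℝ → ℝ := fun p => -(V p * fderiv ℝ S p (1, 0)) with hg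
  have hfc : ContDiff ℝ ∞ f := hVc.mul (hdir _)
  have hgc : ContDiff ℝ ∞ g := (hVc.mul (hdir _)).neg
  have hdd : ∀ p q q', fderiv ℝ (fun p => fderiv ℝ S p q) p q' =
      fderiv ℝ (fderiv ℝ S) p q' q := by
    intro p q q'
    rw [fderiv_clm_apply (hS'.differentiable (by simp) _) (differentiableAt_const _)]
    simp
  have hdiv : ∀ p : ℝ × ℝ, fderiv ℝ f p (1, 0) + fderiv ℝ g p (0, 1) =
      p.1 * inner ℝ (gradient v (Φ p)) (-Complex.I * gradient s (Φ p)) := by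
    intro p
    have hsymm : IsSymmSndFDerivAt ℝ S p :=
      hSc.contDiffAt.isSymmSndFDerivAt (by
        simpa using WithTop.coe_le_coe.2 (le_top : (2 : ℕ∞) ≤ ⊤))
    have e1 : fderiv ℝ f p (1, 0) = V p * fderiv ℝ (fderiv ℝ S) p (1, 0) (0, 1) +
        fderiv ℝ V p (1, 0) * fderiv ℝ S p (0, 1) := by
      rw [hf, fderiv_fun_mul (hVc.differentiable (by simp) _)
        ((hdir _).differentiable (by simp) _)]
      simp [hdd, mul_comm]
    have e2 : fderiv ℝ g p (0, 1) = -(V p * fderiv ℝ (fderiv ℝ S) p (0, 1) (1, 0) +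
        fderiv ℝ V p (0, 1) * fderiv ℝ S p (1, 0)) := by
      rw [hg, fderiv_fun_neg, fderiv_fun_mul (hVc.differentiable (by simp) _)
        ((hdir _).differentiable (by simp) _)]
      simp [hdd, mul_comm]
    rw [e1, e2, hsymm (1, 0) (0, 1), hV, hS, chain hv, chain hv, chain hs, chain hs, hΦr, hΦt]
    set e := Complex.exp (p.2 * Complex.I) with he
    have hee : e.re * e.re + e.im * e.im = 1 := by
      have := Complex.sq_norm e
      rw [he, Complex.norm_exp_ofReal_mul_I, ← he, Complex.normSq_apply] at this
      linarith
    have hΦe : Φ p = p.1 * e := rfl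
    generalize gradient v (Φ p) = a
    generalize gradient s (Φ p) = b
    rw [hΦe]
    simp only [Complex.inner, Complex.mul_re, Complex.mul_im, Complex.conj_re, Complex.conj_im,
      Complex.I_re, Complex.I_im, Complex.ofReal_re, Complex.ofReal_im, Complex.neg_re,
      Complex.neg_im]
    linear_combination (p.1 * (a.re * b.im - a.im * b.re)) * hee
  have key := integral2_divergence_prod_of_hasFDerivAt_off_countable f g (fderiv ℝ f) (fderiv ℝ g)
    0 (-Real.pi) 1 Real.pi ∅ Set.countable_empty hfc.continuous.continuousOn
    hgc.continuous.continuousOn (fun p _ => (hfc.differentiable (by simp) p).hasFDerivAt)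
    (fun p _ => (hgc.differentiable (by simp) p).hasFDerivAt)
    (by
      refine ContinuousOn.integrableOn_compact (isCompact_uIcc.prod isCompact_uIcc)
        (Continuous.continuousOn ?_)
      exact ((hfc.continuous_fderiv (by simp)).clm_apply continuous_const).add
        ((hgc.continuous_fderiv (by simp)).clm_apply continuous_const))
  have hper : ∀ x : ℝ, g (x, Real.pi) = g (x, -Real.pi) := by
    intro x
    have h1 : Φ (x, Real.pi) = Φ (x, -Real.pi) := by
      simp only [hΦ]
      push_cast
      rw [neg_mul, Complex.exp_neg, Complex.exp_pi_mul_I]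
      norm_num
    have h2 : Complex.exp (((x, Real.pi) : ℝ × ℝ).2 * Complex.I) =
        Complex.exp (((x, -Real.pi) : ℝ × ℝ).2 * Complex.I) := by
      push_cast
      rw [neg_mul, Complex.exp_neg, Complex.exp_pi_mul_I]
      norm_num
    simp only [hg, hS, hV, chain hs, hΦr, Function.comp]
    rw [h1]
    congr 3
  have hf0 : ∀ y : ℝ, f (0, y) = 0 := by
    intro y
    simp only [hf, hS, chain hs, hΦt]
    simp [hΦ]
  have hf1 : ∀ y : ℝ, f (1, y) = v (bdryPoint (y : Angles)) *
      inner ℝ (gradient s (bdryPoint (y : Angles))) (Complex.I * bdryPoint (y : Angles)) := by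
    intro y
    simp only [hf, hS, hV, chain hs, hΦt, bdryPoint_coe, Function.comp]
    simp [hΦ]
  simp only [hdiv, hper, hf0, hf1, sub_self, zero_add, intervalIntegral.integral_zero,
    sub_zero] at key
  have harc := integral_arc (fun θ => v (bdryPoint θ) *
      inner ℝ (gradient s (bdryPoint θ)) (Complex.I * bdryPoint θ)) (-Real.pi)
  rw [show -Real.pi + 2 * Real.pi = Real.pi by ring, smul_eq_mul] at harc
  rw [← harc, ← key]
  -- Polar coordinates on the disk.
  set J : ℂ → ℝ := fun x => inner ℝ (gradient v x) (-Complex.I * gradient s x) with hJ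
  have hJc : Continuous J :=
    (continuous_gradient hv).inner (continuous_const.mul (continuous_gradient hs))
  have hpol := Complex.integral_comp_polarCoord_symm (Ω.indicator J)
  rw [integral_indicator (by exact Metric.isOpen_ball.measurableSet)] at hpol
  rw [volΩ, ← hpol]
  have hsymmΦ : ∀ p : ℝ × ℝ, Complex.polarCoord.symm p = Φ p := by
    intro p
    rw [Complex.polarCoord_symm_apply]
    simp only [hΦ, Complex.exp_mul_I, Complex.ofReal_cos, Complex.ofReal_sin]
  have hset : ∀ p ∈ polarCoord.target, p.1 • Ω.indicator J (Complex.polarCoord.symm p) =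
      (Set.Ioo (0 : ℝ) 1 ×ˢ Set.Ioo (-Real.pi) Real.pi).indicator (fun p => p.1 * J (Φ p)) p := by
    intro p hp
    rw [polarCoord_target] at hp
    have hp0 : 0 < p.1 := hp.1
    have hn : ‖Φ p‖ = p.1 := by
      rw [hΦ]
      simp [Complex.norm_exp_ofReal_mul_I, abs_of_pos hp0]
    rw [hsymmΦ]
    by_cases h1 : p.1 < 1
    · rw [Set.indicator_of_mem (by simpa [Ω, hn] using h1),
        Set.indicator_of_mem (show p ∈ Set.Ioo (0 : ℝ) 1 ×ˢ Set.Ioo (-Real.pi) Real.pi from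
          ⟨⟨hp0, h1⟩, hp.2⟩)]
      rfl
    · rw [Set.indicator_of_notMem (by simpa [Ω, hn] using h1),
        Set.indicator_of_notMem (fun h => h1 h.1.2), smul_zero]
  have hmeas : MeasurableSet (Set.Ioo (0 : ℝ) 1 ×ˢ Set.Ioo (-Real.pi) Real.pi) :=
    measurableSet_Ioo.prod measurableSet_Ioo
  rw [setIntegral_congr_fun polarCoord.open_target.measurableSet hset,
    setIntegral_indicator hmeas]
  have hinter : polarCoord.target ∩ Set.Ioo (0 : ℝ) 1 ×ˢ Set.Ioo (-Real.pi) Real.pi =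
      Set.Ioo (0 : ℝ) 1 ×ˢ Set.Ioo (-Real.pi) Real.pi := by
    refine Set.inter_eq_right.2 fun p hp => ?_
    rw [polarCoord_target]
    exact ⟨hp.1.1, hp.2⟩
  have hcont : Continuous fun p : ℝ × ℝ => p.1 * J (Φ p) :=
    continuous_fst.mul (hJc.comp hΦc.continuous)
  rw [hinter, Measure.volume_eq_prod, setIntegral_prod]
  · rw [intervalIntegral.integral_of_le zero_le_one, integral_Ioc_eq_integral_Ioo]
    refine setIntegral_congr_fun measurableSet_Ioo fun x _ => ?_
    simp only
    rw [intervalIntegral.integral_of_le (by linarith [Real.pi_pos]), integral_Ioc_eq_integral_Ioo]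
  · refine IntegrableOn.mono_set (t := Set.Icc (0 : ℝ) 1 ×ˢ Set.Icc (-Real.pi) Real.pi) ?_
      (Set.prod_mono Set.Ioo_subset_Icc_self Set.Ioo_subset_Icc_self)
    exact hcont.continuousOn.integrableOn_compact (isCompact_Icc.prod isCompact_Icc)

theorem real_inner_eq_mul (x y : ℝ) : inner ℝ x y = x * y := by simp [mul_comm]

/-! ### Sobolev functions as limits of smooth functions -/

theorem memLp_volΩ_of_continuous {E : Type*} [NormedAddCommGroup E] [SecondCountableTopology E]
    {f : ℂ → E} (hf : Continuous f) : MemLp f 2 volΩ := by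
  obtain ⟨C, hC⟩ := (isCompact_closedBall (0 : ℂ) 1).exists_bound_of_continuousOn hf.continuousOn
  refine MemLp.of_bound hf.aestronglyMeasurable C ?_
  rw [volΩ, ae_restrict_iff' (show MeasurableSet Ω from Metric.isOpen_ball.measurableSet)]
  exact Eventually.of_forall fun x hx => hC x (Metric.ball_subset_closedBall hx)

theorem memLp_arc_of_continuous {f : Angles → ℝ} (hf : Continuous f) : MemLp f 2 arc :=
  (hf.memLp_top_of_hasCompactSupport (HasCompactSupport.of_compactSpace _) arc).mono_exponent le_top

/-- The weak gradient is a closed operator, so limits of smooth functions lie in `H¹(Ω)`. -/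
theorem HasTrace.isH1 {u : ℂ → ℝ} {G : ℂ → ℂ} {f : Angles → ℝ} (h : HasTrace u G f)
    (hu : MemLp u 2 volΩ) (hG : MemLp G 2 volΩ) : IsH1 u G := by
  refine ⟨hu, hG, fun φ hφ y => ?_⟩
  obtain ⟨v, hv, hvu, hvG, -⟩ := h
  obtain ⟨hφc, hφs, hφΩ⟩ := hφ
  have hφ' : Continuous fun x => fderiv ℝ φ x y :=
    (hφc.continuous_fderiv (by simp)).clm_apply continuous_const
  have hφy : Continuous fun x => φ x • y := hφc.continuous.smul continuous_const
  have hzero : ∀ x, x ∉ Ω → φ x = 0 := fun x hx =>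
    image_eq_zero_of_notMem_tsupport fun hx' => hx (hφΩ hx')
  have hzero' : ∀ x, x ∉ Ω → fderiv ℝ φ x y = 0 := fun x hx => by
    have h0 : x ∉ tsupport (fderiv ℝ φ) := fun hx' => hx (hφΩ (tsupport_fderiv_subset ℝ hx'))
    rw [image_eq_zero_of_notMem_tsupport h0]
    rfl
  have hsm : ∀ k, ∫ x, inner ℝ (v k x) (fderiv ℝ φ x y) ∂volΩ =
      -∫ x, inner ℝ (gradient (v k) x) (φ x • y) ∂volΩ := by
    intro k
    have hvd : Continuous fun x => fderiv ℝ (v k) x y :=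
      ((hv k).continuous_fderiv (by simp)).clm_apply continuous_const
    have hφ's : HasCompactSupport fun x => fderiv ℝ φ x y := hφs.fderiv_apply ℝ y
    have key := integral_mul_fderiv_eq_neg_fderiv_mul_of_integrable (μ := (volume : Measure ℂ))
      (f := v k) (g := φ) (v := y)
      ((hvd.mul hφc.continuous).integrable_of_hasCompactSupport hφs.mul_left)
      (((hv k).continuous.mul hφ').integrable_of_hasCompactSupport hφ's.mul_left)
      (((hv k).continuous.mul hφc.continuous).integrable_of_hasCompactSupport hφs.mul_left)
      (fun x _ => (hv k).differentiable (by simp) x)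
      (fun x _ => hφc.differentiable (by simp) x)
    rw [volΩ, setIntegral_eq_integral_of_forall_compl_eq_zero (fun x hx => by
        rw [hzero' x hx, inner_zero_right]),
      setIntegral_eq_integral_of_forall_compl_eq_zero (fun x hx => by
        rw [hzero x hx, zero_smul, inner_zero_right])]
    simp only [real_inner_smul_right, ← fderiv_eq_inner_gradient, real_inner_eq_mul]
    simpa only [mul_comm (φ _)] using key
  have h1 := tendsto_integral_inner (fun k => memLp_volΩ_of_continuous (hv k).continuous)
    (fun _ => memLp_volΩ_of_continuous hφ') hu (memLp_volΩ_of_continuous hφ') hvu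
    (by simp only [sub_self, eLpNorm_zero', tendsto_const_nhds])
  have h2 := tendsto_integral_inner
    (fun k => memLp_volΩ_of_continuous (continuous_gradient (hv k)))
    (fun _ => memLp_volΩ_of_continuous hφy) hG (memLp_volΩ_of_continuous hφy) hvG
    (by simp only [sub_self, eLpNorm_zero', tendsto_const_nhds])
  have h3 := tendsto_nhds_unique h1 (h2.neg.congr fun k => (hsm k).symm)
  simp only [real_inner_smul_right, real_inner_eq_mul] at h3
  simpa only [mul_comm (φ _)] using h3

/-- Green's formula for the divergence free field `-i S`, where `S` is a limit of gradients of
smooth stream functions whose tangential derivatives on the circle tend to `τ`. -/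
theorem HasTrace.integral_inner_rot {u : ℂ → ℝ} {U : ℂ → ℂ} {f : Angles → ℝ}
    (h : HasTrace u U f) (hU : MemLp U 2 volΩ) (hf : MemLp f 2 arc)
    {s : ℕ → ℂ → ℝ} {S : ℂ → ℂ} {τ : Angles → ℝ} (hs : ∀ k, ContDiff ℝ ∞ (s k))
    (hS : MemLp S 2 volΩ) (hτ : MemLp τ 2 arc)
    (hsS : Tendsto (fun k => eLpNorm (fun x => gradient (s k) x - S x) 2 volΩ) atTop (𝓝 0))
    (hsτ : Tendsto (fun k => eLpNorm (fun θ => inner ℝ (gradient (s k) (bdryPoint θ))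
      (Complex.I * bdryPoint θ) - τ θ) 2 arc) atTop (𝓝 0)) :
    ∫ x, inner ℝ (U x) (-Complex.I * S x) ∂volΩ = (2 * Real.pi) * ∫ θ, f θ * τ θ ∂arc := by
  obtain ⟨v, hv, -, hvU, hvf⟩ := h
  have hrot : ∀ k, Continuous fun x => -Complex.I * gradient (s k) x := fun k =>
    continuous_const.mul (continuous_gradient (hs k))
  have htan : ∀ k, Continuous fun θ =>
      inner ℝ (gradient (s k) (bdryPoint θ)) (Complex.I * bdryPoint θ) := fun k =>
    ((continuous_gradient (hs k)).comp continuous_bdryPoint).inner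
      (continuous_const.mul continuous_bdryPoint)
  have hvc : ∀ k, Continuous fun θ => v k (bdryPoint θ) := fun k =>
    (hv k).continuous.comp continuous_bdryPoint
  have h1 := tendsto_integral_inner
    (fun k => memLp_volΩ_of_continuous (continuous_gradient (hv k)))
    (fun k => memLp_volΩ_of_continuous (hrot k)) hU (hS.const_mul (-Complex.I)) hvU (by
      refine hsS.congr fun k => eLpNorm_congr_norm_ae (Eventually.of_forall fun x => ?_)
      rw [← mul_sub, norm_mul, norm_neg, Complex.norm_I, one_mul])
  have h2 := (tendsto_integral_inner (fun k => memLp_arc_of_continuous (hvc k))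
    (fun k => memLp_arc_of_continuous (htan k)) hf hτ hvf hsτ).const_mul (2 * Real.pi)
  simp only [integral_inner_rot_gradient (hv _) (hs _)] at h1
  simp only [real_inner_eq_mul] at h2
  exact tendsto_nhds_unique h1 h2

/-! ### Transmission fields and their smooth approximations -/

/-- A smooth approximation, for small `ε ≠ 0`, of `max t (R ^ 2)`. -/
def smoothMax (R ε t : ℝ) : ℝ := (t + R ^ 2 + √((t - R ^ 2) ^ 2 + ε ^ 2)) / 2

/-- The derivative of `smoothMax R ε`. -/
def smoothStep (R ε t : ℝ) : ℝ := (1 + (t - R ^ 2) / √((t - R ^ 2) ^ 2 + ε ^ 2)) / 2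

theorem max_le_smoothMax (R ε t : ℝ) : max t (R ^ 2) ≤ smoothMax R ε t := by
  have h : |t - R ^ 2| ≤ √((t - R ^ 2) ^ 2 + ε ^ 2) :=
    Real.abs_le_sqrt (by nlinarith [sq_nonneg ε])
  have h1 := le_abs_self (t - R ^ 2)
  have h2 := neg_le_abs (t - R ^ 2)
  rw [smoothMax]
  exact max_le (by linarith) (by linarith)

theorem smoothMax_pos {R : ℝ} (hR : 0 < R) (ε t : ℝ) : 0 < smoothMax R ε t :=
  (by positivity : (0 : ℝ) < R ^ 2).trans_le ((le_max_right _ _).trans (max_le_smoothMax R ε t))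

theorem smoothStep_mem_Icc (R ε t : ℝ) : smoothStep R ε t ∈ Set.Icc (0 : ℝ) 1 := by
  have h : |t - R ^ 2| ≤ √((t - R ^ 2) ^ 2 + ε ^ 2) :=
    Real.abs_le_sqrt (by nlinarith [sq_nonneg ε])
  have h1 : |(t - R ^ 2) / √((t - R ^ 2) ^ 2 + ε ^ 2)| ≤ 1 := by
    rw [abs_div, abs_of_nonneg (Real.sqrt_nonneg _)]
    exact div_le_one_of_le₀ h (Real.sqrt_nonneg _)
  rw [abs_le] at h1
  rw [smoothStep]
  constructor <;> linarith [h1.1, h1.2]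

theorem hasDerivAt_smoothMax {R ε : ℝ} (hε : ε ≠ 0) (t : ℝ) :
    HasDerivAt (smoothMax R ε) (smoothStep R ε t) t := by
  have hpos : 0 < (t - R ^ 2) ^ 2 + ε ^ 2 := by positivity
  have h1 : HasDerivAt (fun t => (t - R ^ 2) ^ 2 + ε ^ 2) (2 * (t - R ^ 2)) t := by
    simpa using (((hasDerivAt_id t).sub_const (R ^ 2)).pow 2).add_const (ε ^ 2)
  have h2 := (((hasDerivAt_id t).add_const (R ^ 2)).add (h1.sqrt hpos.ne')).div_const 2
  refine h2.congr_deriv ?_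
  rw [smoothStep]
  field_simp

theorem contDiff_smoothMax {R ε : ℝ} (hε : ε ≠ 0) : ContDiff ℝ ∞ (smoothMax R ε) := by
  refine ((contDiff_id.add contDiff_const).add (ContDiff.sqrt ?_ fun t => ?_)).div_const 2
  · exact ((contDiff_id.sub contDiff_const).pow 2).add contDiff_const
  · have : 0 < (t - R ^ 2) ^ 2 + ε ^ 2 := by positivity
    exact this.ne'

theorem tendsto_smoothMax (R t : ℝ) :
    Tendsto (fun ε => smoothMax R ε t) (𝓝 0) (𝓝 (max t (R ^ 2))) := by
  have h : Continuous fun ε => smoothMax R ε t := by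
    unfold smoothMax
    fun_prop
  have h0 : smoothMax R 0 t = max t (R ^ 2) := by
    rw [smoothMax, zero_pow two_ne_zero, add_zero, Real.sqrt_sq_eq_abs]
    rcases le_total t (R ^ 2) with h | h
    · rw [abs_of_nonpos (by linarith), max_eq_right h]
      ring
    · rw [abs_of_nonneg (by linarith), max_eq_left h]
      ring
  rw [← h0]
  exact h.tendsto 0

theorem tendsto_smoothStep {R t : ℝ} (ht : t ≠ R ^ 2) :
    Tendsto (fun ε => smoothStep R ε t) (𝓝 0) (𝓝 (if t < R ^ 2 then 0 else 1)) := by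
  have hne : t - R ^ 2 ≠ 0 := sub_ne_zero.2 ht
  have h : ContinuousAt (fun ε => smoothStep R ε t) 0 := by
    unfold smoothStep
    refine ((continuousAt_const.add (continuousAt_const.div ?_ ?_)).div_const 2)
    · fun_prop
    · have : 0 < (t - R ^ 2) ^ 2 + 0 ^ 2 := by positivity
      exact (Real.sqrt_pos.2 this).ne'
  have h0 : smoothStep R 0 t = if t < R ^ 2 then 0 else 1 := by
    rw [smoothStep, zero_pow two_ne_zero, add_zero, Real.sqrt_sq_eq_abs]
    split_ifs with hlt
    · rw [abs_of_neg (by linarith), div_neg, div_self hne]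
      norm_num
    · rw [abs_of_pos (by push Not at hlt; exact sub_pos.2 (lt_of_le_of_ne hlt (Ne.symm ht))),
        div_self hne]
      norm_num
  rw [← h0]
  exact h

/-- The continuous and piecewise smooth function `Re (b ζⁿ) (a + d min(1, R²/|ζ|²)ⁿ)` with
`ζ = z - c` and `n = m + 1`. It is harmonic off the circle `|ζ| = R`: it equals
`Re ((a + d) b ζⁿ)` inside and `Re (a b ζⁿ + d b̄ R²ⁿ ζ⁻ⁿ)` outside. -/
def transVal (c : ℂ) (R : ℝ) (m : ℕ) (b : ℂ) (a d : ℝ) (z : ℂ) : ℝ :=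
  (b * (z - c) ^ (m + 1)).re * (a + d * (R ^ 2 / max (‖z - c‖ ^ 2) (R ^ 2)) ^ (m + 1))

open Classical in
/-- The gradient of `transVal`, extended to the circle `|z - c| = R` from outside. -/
def transFld (c : ℂ) (R : ℝ) (m : ℕ) (b : ℂ) (a d : ℝ) (z : ℂ) : ℂ :=
  if z ∈ Metric.ball c R then (a + d) * ((m + 1) * starRingEnd ℂ (b * (z - c) ^ m))
  else a * ((m + 1) * starRingEnd ℂ (b * (z - c) ^ m)) -
    d * ((m + 1) * (b * R ^ (2 * (m + 1)) / starRingEnd ℂ (z - c) ^ (m + 2)))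

/-- `transVal` with the maximum replaced by its smooth approximation. -/
def transApprox (c : ℂ) (R : ℝ) (m : ℕ) (b : ℂ) (a d ε : ℝ) (z : ℂ) : ℝ :=
  (b * (z - c) ^ (m + 1)).re * (a + d * (R ^ 2 / smoothMax R ε (‖z - c‖ ^ 2)) ^ (m + 1))

/-- The common formula for the values of `transVal` and `transApprox` in terms of `ζ = z - c` and
the quotient `x = R² / max`. -/
def valFormula (m : ℕ) (b : ℂ) (a d : ℝ) (ζ : ℂ) (x : ℝ) : ℝ :=
  (b * ζ ^ (m + 1)).re * (a + d * x ^ (m + 1))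

/-- The common formula for the gradients, with the derivative `y` of the maximum as an additional
variable. -/
def gradFormula (R : ℝ) (m : ℕ) (b : ℂ) (a d : ℝ) (ζ : ℂ) (x y : ℝ) : ℂ :=
  ((a + d * x ^ (m + 1) : ℝ) : ℂ) * ((m + 1) * starRingEnd ℂ (b * ζ ^ m)) -
    ((2 * (b * ζ ^ (m + 1)).re * (d * ((m + 1) * x ^ (m + 2) / R ^ 2 * y)) : ℝ) : ℂ) * ζ

theorem contDiff_transApprox (c : ℂ) {R : ℝ} (hR : 0 < R) (m : ℕ) (b : ℂ) (a d : ℝ) {ε : ℝ}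
    (hε : ε ≠ 0) : ContDiff ℝ ∞ (transApprox c R m b a d ε) := by
  have hζ : ContDiff ℝ ∞ fun z : ℂ => z - c := contDiff_id.sub contDiff_const
  refine (Complex.reCLM.contDiff.comp (contDiff_const.mul (hζ.pow _))).mul
    (contDiff_const.add (contDiff_const.mul (ContDiff.pow (contDiff_const.div ?_ ?_) _)))
  · exact (contDiff_smoothMax hε).comp (hζ.norm_sq ℝ)
  · exact fun z => (smoothMax_pos hR _ _).ne'

theorem gradient_transApprox (c : ℂ) {R : ℝ} (hR : 0 < R) (m : ℕ) (b : ℂ) (a d : ℝ) {ε : ℝ}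
    (hε : ε ≠ 0) (z : ℂ) :
    gradient (transApprox c R m b a d ε) z = gradFormula R m b a d (z - c)
      (R ^ 2 / smoothMax R ε (‖z - c‖ ^ 2)) (smoothStep R ε (‖z - c‖ ^ 2)) := by
  refine ext_inner_right ℝ fun y => ?_
  rw [← fderiv_eq_inner_gradient]
  have hMpos := smoothMax_pos hR ε (‖z - c‖ ^ 2)
  -- Restrict to the line through `z` in the direction `y`.
  have hl : HasDerivAt (fun t : ℝ => z + (t : ℂ) * y) y 0 := by
    simpa using (((hasDerivAt_id (0 : ℝ)).ofReal_comp).mul_const y).const_add z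
  have hlc : HasDerivAt (fun t : ℝ => z + (t : ℂ) * y - c) y 0 := hl.sub_const c
  have h1 : HasDerivAt (fun t : ℝ => transApprox c R m b a d ε (z + (t : ℂ) * y))
      (fderiv ℝ (transApprox c R m b a d ε) z y) 0 := by
    have h := ((contDiff_transApprox c hR m b a d hε).differentiable (by simp)
      (z + ((0 : ℝ) : ℂ) * y)).hasFDerivAt.comp_hasDerivAt (0 : ℝ) hl
    simpa [Function.comp_def] using h
  have hp : HasDerivAt (fun t : ℝ => (b * (z + (t : ℂ) * y - c) ^ (m + 1)).re)
      ((b * ((m + 1) * (z - c) ^ m * y)).re) 0 := by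
    have h := Complex.reCLM.hasFDerivAt.comp_hasDerivAt (0 : ℝ) ((hlc.pow (m + 1)).const_mul b)
    simpa [Function.comp_def] using h
  have hn : HasDerivAt (fun t : ℝ => ‖z + (t : ℂ) * y - c‖ ^ 2) (2 * inner ℝ (z - c) y) 0 := by
    simpa using hlc.norm_sq
  have hM : HasDerivAt (fun t : ℝ => smoothMax R ε (‖z + (t : ℂ) * y - c‖ ^ 2))
      (smoothStep R ε (‖z - c‖ ^ 2) * (2 * inner ℝ (z - c) y)) 0 := by
    have h := (hasDerivAt_smoothMax (R := R) hε
      (‖z + ((0 : ℝ) : ℂ) * y - c‖ ^ 2)).comp (0 : ℝ) hn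
    simpa [Function.comp_def] using h
  have hq := (hM.fun_inv (by simpa using hMpos.ne')).const_mul (R ^ 2)
  have h2 := hp.mul (((hq.pow (m + 1)).const_mul d).const_add a)
  have h3 := h2.congr_of_eventuallyEq
    (f₁ := fun t : ℝ => transApprox c R m b a d ε (z + (t : ℂ) * y))
    (Eventually.of_forall fun t => by
      simp only [transApprox, div_eq_mul_inv, Pi.mul_apply, Pi.pow_apply])
  rw [h1.unique h3]
  simp only [Pi.pow_apply, Complex.ofReal_zero, zero_mul, add_zero, gradFormula]
  set M := smoothMax R ε (‖z - c‖ ^ 2)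
  set σ := smoothStep R ε (‖z - c‖ ^ 2)
  have hlin : ∀ (r s : ℝ) (p q : ℂ), inner ℝ ((r : ℂ) * p - (s : ℂ) * q) y =
      r * inner ℝ p y - s * inner ℝ q y := by
    intro r s p q
    rw [inner_sub_left, ← Complex.real_smul, ← Complex.real_smul, real_inner_smul_left,
      real_inner_smul_left]
  rw [hlin]
  have e1 : (b * ((m + 1) * (z - c) ^ m * y)).re =
      inner ℝ ((m + 1) * starRingEnd ℂ (b * (z - c) ^ m) : ℂ) y := by
    rw [Complex.inner]
    congr 1
    simp
    ring
  rw [e1]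
  have hM0 : M ≠ 0 := hMpos.ne'
  have hR0 : R ≠ 0 := hR.ne'
  simp only [div_eq_mul_inv, Nat.add_sub_cancel, Nat.cast_add, Nat.cast_one]
  rw [pow_succ (R ^ 2 * M⁻¹) (m + 1), pow_succ (R ^ 2 * M⁻¹) m]
  generalize (R ^ 2 * M⁻¹) ^ m = w
  field_simp
  ring

theorem continuous_valFormula (m : ℕ) (b : ℂ) (a d : ℝ) :
    Continuous fun p : ℂ × ℝ × ℝ => valFormula m b a d p.1 p.2.1 := by
  unfold valFormula
  fun_prop

theorem continuous_gradFormula (R : ℝ) (m : ℕ) (b : ℂ) (a d : ℝ) :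
    Continuous fun p : ℂ × ℝ × ℝ => gradFormula R m b a d p.1 p.2.1 p.2.2 := by
  unfold gradFormula
  simp only [div_eq_mul_inv]
  fun_prop

theorem transFld_eq_gradFormula (c : ℂ) {R : ℝ} (hR : 0 < R) (m : ℕ) (b : ℂ) (a d : ℝ) {z : ℂ} :
    transFld c R m b a d z = gradFormula R m b a d (z - c) (R ^ 2 / max (‖z - c‖ ^ 2) (R ^ 2))
      (if ‖z - c‖ ^ 2 < R ^ 2 then 0 else 1) := by
  have hR0 : R ≠ 0 := hR.ne'
  have hiff : z ∈ Metric.ball c R ↔ ‖z - c‖ ^ 2 < R ^ 2 := by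
    rw [mem_ball_iff_norm, sq_lt_sq₀ (norm_nonneg _) hR.le]
  rw [transFld, gradFormula]
  simp only [hiff]
  split_ifs with h
  · rw [max_eq_right h.le, div_self (by positivity)]
    simp
  · push Not at h
    rw [max_eq_left h]
    set ζ := z - c with hζ
    have hpos : 0 < ‖ζ‖ ^ 2 := (by positivity : 0 < R ^ 2).trans_le h
    have hζ0 : ζ ≠ 0 := fun h0 => by simp [h0] at hpos
    have hζc : starRingEnd ℂ ζ ≠ 0 := (map_ne_zero _).2 hζ0
    have hn : ((‖ζ‖ : ℝ) : ℂ) ^ 2 = ζ * starRingEnd ℂ ζ := by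
      rw [Complex.mul_conj, Complex.normSq_eq_norm_sq]
      push_cast
      rfl
    have hre : ((2 * (b * ζ ^ (m + 1)).re : ℝ) : ℂ) =
        b * ζ ^ (m + 1) + starRingEnd ℂ (b * ζ ^ (m + 1)) := by
      rw [Complex.add_conj]
    have hR0' : (R : ℂ) ≠ 0 := by exact_mod_cast hR0
    rw [Complex.ofReal_mul (2 * (b * ζ ^ (m + 1)).re), hre]
    push_cast
    rw [hn]
    simp only [map_mul, map_pow, div_pow, mul_pow]
    set w := starRingEnd ℂ ζ
    field_simp
    ring

/-- Sequences built from the two formulas converge in `L²`: they are bounded because the formulas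
are continuous and their variables stay in a compact set, and they converge pointwise off the
circle `|z - c| = R`. The variables are read off along a map `p` into the plane, so that the same
statement serves the disk and its boundary. -/
theorem tendsto_formula {α E : Type*} [MeasurableSpace α] {μ : Measure α} [IsFiniteMeasure μ]
    [NormedAddCommGroup E] (c : ℂ) {R : ℝ} (hR : 0 < R) {p : α → ℂ}
    (hp : AEStronglyMeasurable p μ) {K : ℝ} (hK : ∀ᵐ x ∂μ, ‖p x - c‖ ≤ K)
    (hne : ∀ᵐ x ∂μ, ‖p x - c‖ ≠ R) {Ψ : ℂ × ℝ × ℝ → E} (hΨ : Continuous Ψ) :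
    MemLp (fun x => Ψ (p x - c, R ^ 2 / max (‖p x - c‖ ^ 2) (R ^ 2),
      if ‖p x - c‖ ^ 2 < R ^ 2 then 0 else 1)) 2 μ ∧
    Tendsto (fun k : ℕ => eLpNorm (fun x =>
      Ψ (p x - c, R ^ 2 / smoothMax R (1 / ((k : ℝ) + 1)) (‖p x - c‖ ^ 2),
        smoothStep R (1 / ((k : ℝ) + 1)) (‖p x - c‖ ^ 2)) -
      Ψ (p x - c, R ^ 2 / max (‖p x - c‖ ^ 2) (R ^ 2),
        if ‖p x - c‖ ^ 2 < R ^ 2 then 0 else 1)) 2 μ) atTop (𝓝 0) := by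
  set F : ℕ → α → E := fun k x =>
      Ψ (p x - c, R ^ 2 / smoothMax R (1 / ((k : ℝ) + 1)) (‖p x - c‖ ^ 2),
        smoothStep R (1 / ((k : ℝ) + 1)) (‖p x - c‖ ^ 2)) with hF
  set f : α → E := fun x => Ψ (p x - c, R ^ 2 / max (‖p x - c‖ ^ 2) (R ^ 2),
        if ‖p x - c‖ ^ 2 < R ^ 2 then 0 else 1) with hf
  have hε : ∀ k : ℕ, (1 / ((k : ℝ) + 1)) ≠ 0 := fun k => by positivity
  have hFm : ∀ k, AEStronglyMeasurable (F k) μ := by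
    intro k
    have hc : Continuous fun ζ : ℂ => (ζ - c, R ^ 2 / smoothMax R (1 / ((k : ℝ) + 1)) (‖ζ - c‖ ^ 2),
        smoothStep R (1 / ((k : ℝ) + 1)) (‖ζ - c‖ ^ 2)) := by
      have h1 : Continuous fun ζ : ℂ => ‖ζ - c‖ ^ 2 := by fun_prop
      refine (continuous_id.sub continuous_const).prodMk
        ((continuous_const.div ((contDiff_smoothMax (hε k)).continuous.comp h1)
          fun ζ => (smoothMax_pos hR _ _).ne').prodMk ?_)
      have h2 : Continuous (smoothStep R (1 / ((k : ℝ) + 1))) := by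
        unfold smoothStep
        refine (continuous_const.add (Continuous.div (by fun_prop) (by fun_prop)
          fun t => ?_)).div_const 2
        have := hε k
        positivity
      exact h2.comp h1
    exact (hΨ.comp hc).comp_aestronglyMeasurable hp
  have hlim : ∀ᵐ x ∂μ, Tendsto (fun k => F k x) atTop (𝓝 (f x)) := by
    filter_upwards [hne] with x hx
    have hx' : ‖p x - c‖ ^ 2 ≠ R ^ 2 := fun h =>
      hx ((sq_eq_sq₀ (norm_nonneg _) hR.le).1 h)
    have hk := tendsto_one_div_add_atTop_nhds_zero_nat (𝕜 := ℝ)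
    have hmax : max (‖p x - c‖ ^ 2) (R ^ 2) ≠ 0 :=
      ((by positivity : 0 < R ^ 2).trans_le (le_max_right _ _)).ne'
    exact (hΨ.tendsto _).comp (tendsto_const_nhds.prodMk_nhds
      ((tendsto_const_nhds.div ((tendsto_smoothMax R _).comp hk) hmax).prodMk_nhds
        ((tendsto_smoothStep hx').comp hk)))
  have hfm : AEStronglyMeasurable f μ := aestronglyMeasurable_of_tendsto_ae atTop hFm hlim
  have hcomp : IsCompact (Metric.closedBall (0 : ℂ) K ×ˢ Set.Icc (0 : ℝ) 1 ×ˢ Set.Icc (0 : ℝ) 1) :=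
    (isCompact_closedBall _ _).prod (isCompact_Icc.prod isCompact_Icc)
  obtain ⟨C, hC⟩ := hcomp.exists_bound_of_continuousOn hΨ.continuousOn
  have hx01 : ∀ M : ℝ, R ^ 2 ≤ M → R ^ 2 / M ∈ Set.Icc (0 : ℝ) 1 := fun M hM =>
    ⟨div_nonneg (sq_nonneg R) ((sq_nonneg R).trans hM),
      div_le_one_of_le₀ hM ((sq_nonneg R).trans hM)⟩
  have hFb : ∀ k, ∀ᵐ x ∂μ, ‖F k x‖ ≤ C := by
    intro k
    filter_upwards [hK] with x hx
    exact hC _ ⟨by simpa using hx, hx01 _ ((le_max_right _ _).trans (max_le_smoothMax _ _ _)),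
      smoothStep_mem_Icc _ _ _⟩
  have hfb : ∀ᵐ x ∂μ, ‖f x‖ ≤ C := by
    filter_upwards [hK] with x hx
    exact hC _ ⟨by simpa using hx, hx01 _ (le_max_right _ _), by split_ifs <;> simp⟩
  exact ⟨MemLp.of_bound hfm C hfb, tendsto_eLpNorm_of_dominated C hFm hfm hFb hlim⟩

/-! ### Traces, weak gradients and Green's formula for the transmission fields -/

theorem norm_add_radius_lt_one {c : ℂ} {R : ℝ} (hR : 0 < R) (hD : Metric.closedBall c R ⊆ Ω) :
    ‖c‖ + R < 1 := by
  rcases eq_or_ne c 0 with rfl | hc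
  · have h : (R : ℂ) ∈ Ω := hD (by simp [abs_of_pos hR])
    simpa [Ω, abs_of_pos hR] using h
  · have hn : 0 < ‖c‖ := norm_pos_iff.2 hc
    have h : c + ((R / ‖c‖ : ℝ) : ℂ) * c ∈ Ω := by
      refine hD ?_
      rw [mem_closedBall_iff_norm, add_sub_cancel_left, norm_mul, Complex.norm_real,
        Real.norm_of_nonneg (by positivity), div_mul_cancel₀ _ hn.ne']
    have e : c + ((R / ‖c‖ : ℝ) : ℂ) * c = ((1 + R / ‖c‖ : ℝ) : ℂ) * c := by
      push_cast
      ring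
    rw [Ω, mem_ball_zero_iff, e, norm_mul, Complex.norm_real,
      Real.norm_of_nonneg (by positivity), add_mul, div_mul_cancel₀ _ hn.ne', one_mul] at h
    exact h

theorem radius_lt_norm_bdryPoint_sub {c : ℂ} {R : ℝ} (hR : 0 < R)
    (hD : Metric.closedBall c R ⊆ Ω) (θ : Angles) : R < ‖bdryPoint θ - c‖ := by
  have h1 := norm_add_radius_lt_one hR hD
  have h2 := norm_sub_norm_le (bdryPoint θ) c
  rw [norm_bdryPoint] at h2
  linarith

theorem ae_volΩ_norm_sub_ne (c : ℂ) {R : ℝ} (hR : 0 < R) : ∀ᵐ x ∂volΩ, ‖x - c‖ ≠ R := by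
  refine ae_restrict_of_ae ?_
  have h := Measure.addHaar_sphere_of_ne_zero (volume : Measure ℂ) c hR.ne'
  filter_upwards [compl_mem_ae_iff.2 h] with x hx hx'
  exact hx (mem_sphere_iff_norm.2 hx')

theorem ae_volΩ_norm_sub_le (c : ℂ) : ∀ᵐ x ∂volΩ, ‖x - c‖ ≤ 1 + ‖c‖ := by
  rw [volΩ, ae_restrict_iff' (show MeasurableSet Ω from Metric.isOpen_ball.measurableSet)]
  refine Eventually.of_forall fun x hx => (norm_sub_le x c).trans ?_
  have : ‖x‖ < 1 := by simpa [Ω] using hx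
  linarith

theorem memLp_transVal (c : ℂ) {R : ℝ} (hR : 0 < R) (m : ℕ) (b : ℂ) (a d : ℝ) :
    MemLp (transVal c R m b a d) 2 volΩ :=
  (tendsto_formula c hR (p := id) aestronglyMeasurable_id (ae_volΩ_norm_sub_le c)
    (ae_volΩ_norm_sub_ne c hR) (continuous_valFormula m b a d)).1

theorem memLp_transFld (c : ℂ) {R : ℝ} (hR : 0 < R) (m : ℕ) (b : ℂ) (a d : ℝ) :
    MemLp (transFld c R m b a d) 2 volΩ := by
  have h := (tendsto_formula c hR (p := id) aestronglyMeasurable_id (ae_volΩ_norm_sub_le c)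
    (ae_volΩ_norm_sub_ne c hR) (continuous_gradFormula R m b a d)).1
  simpa only [id, ← transFld_eq_gradFormula c hR] using h

theorem tendsto_gradient_transApprox (c : ℂ) {R : ℝ} (hR : 0 < R) (m : ℕ) (b : ℂ) (a d : ℝ) :
    Tendsto (fun k : ℕ => eLpNorm (fun x =>
      gradient (transApprox c R m b a d (1 / ((k : ℝ) + 1))) x - transFld c R m b a d x) 2 volΩ)
      atTop (𝓝 0) := by
  have h := (tendsto_formula c hR (p := id) aestronglyMeasurable_id (ae_volΩ_norm_sub_le c)
    (ae_volΩ_norm_sub_ne c hR) (continuous_gradFormula R m b a d)).2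
  have hε : ∀ k : ℕ, (1 / ((k : ℝ) + 1)) ≠ 0 := fun k => by positivity
  simpa only [id, ← transFld_eq_gradFormula c hR, ← gradient_transApprox c hR m b a d (hε _)]
    using h

theorem hasTrace_transVal {c : ℂ} {R : ℝ} (hR : 0 < R) (hD : Metric.closedBall c R ⊆ Ω)
    (m : ℕ) (b : ℂ) (a d : ℝ) :
    HasTrace (transVal c R m b a d) (transFld c R m b a d)
      (fun θ => transVal c R m b a d (bdryPoint θ)) := by
  refine ⟨fun k => transApprox c R m b a d (1 / ((k : ℝ) + 1)),
    fun k => contDiff_transApprox c hR m b a d (by positivity), ?_,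
    tendsto_gradient_transApprox c hR m b a d, ?_⟩
  · exact (tendsto_formula c hR (p := id) aestronglyMeasurable_id (ae_volΩ_norm_sub_le c)
      (ae_volΩ_norm_sub_ne c hR) (continuous_valFormula m b a d)).2
  · exact (tendsto_formula c hR continuous_bdryPoint.aestronglyMeasurable
      (K := 1 + ‖c‖) (Eventually.of_forall fun θ => (norm_sub_le _ _).trans_eq (by
        rw [norm_bdryPoint]))
      (Eventually.of_forall fun θ => (radius_lt_norm_bdryPoint_sub hR hD θ).ne')
      (continuous_valFormula m b a d)).2

theorem isH1_transVal {c : ℂ} {R : ℝ} (hR : 0 < R) (hD : Metric.closedBall c R ⊆ Ω)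
    (m : ℕ) (b : ℂ) (a d : ℝ) : IsH1 (transVal c R m b a d) (transFld c R m b a d) :=
  (hasTrace_transVal hR hD m b a d).isH1 (memLp_transVal c hR m b a d) (memLp_transFld c hR m b a d)

theorem HasTrace.integral_inner_rot_transFld {u : ℂ → ℝ} {U : ℂ → ℂ} {f : Angles → ℝ}
    (h : HasTrace u U f) (hU : MemLp U 2 volΩ) (hf : MemLp f 2 arc) {c : ℂ} {R : ℝ} (hR : 0 < R)
    (hD : Metric.closedBall c R ⊆ Ω) (m : ℕ) (b : ℂ) (a d : ℝ) :
    ∫ x, inner ℝ (U x) (-Complex.I * transFld c R m b a d x) ∂volΩ = (2 * Real.pi) *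
      ∫ θ, f θ * inner ℝ (transFld c R m b a d (bdryPoint θ)) (Complex.I * bdryPoint θ) ∂arc := by
  have hε : ∀ k : ℕ, (1 / ((k : ℝ) + 1)) ≠ 0 := fun k => by positivity
  have hΨ : Continuous fun p : ℂ × ℝ × ℝ =>
      (inner ℝ (gradFormula R m b a d p.1 p.2.1 p.2.2) (Complex.I * (p.1 + c)) : ℝ) :=
    (continuous_gradFormula R m b a d).inner (by fun_prop)
  have hΨ' := tendsto_formula c hR continuous_bdryPoint.aestronglyMeasurable (μ := arc)
      (K := 1 + ‖c‖) (Eventually.of_forall fun θ => (norm_sub_le _ _).trans_eq (by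
        rw [norm_bdryPoint]))
      (Eventually.of_forall fun θ => (radius_lt_norm_bdryPoint_sub hR hD θ).ne') hΨ
  simp only [← transFld_eq_gradFormula c hR, ← gradient_transApprox c hR m b a d (hε _),
    sub_add_cancel] at hΨ'
  exact h.integral_inner_rot hU hf
    (fun k => contDiff_transApprox c hR m b a d (hε k)) (memLp_transFld c hR m b a d) hΨ'.1
    (tendsto_gradient_transApprox c hR m b a d) hΨ'.2

/-- Multiplying `b` by `-i` and changing the sign of `d` passes to the harmonic conjugate. With the
transmission coefficients `α = (1 + σ₂/σ₁)/2` and `β = (1 - σ₂/σ₁)/2` the flux of `transVal` is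
therefore `σ₁` times a rotated gradient, hence divergence free. -/
theorem conductivity_mul_transFld {σ₁ : ℝ} (hσ₁ : σ₁ ≠ 0) (σ₂ : ℝ) (c : ℂ) (R : ℝ) (m : ℕ) (b : ℂ)
    (x : ℂ) :
    (conductivity σ₁ σ₂ (Metric.ball c R) x : ℂ) *
        transFld c R m b ((1 + σ₂ / σ₁) / 2) ((1 - σ₂ / σ₁) / 2) x =
      σ₁ * (-Complex.I * transFld c R m (-Complex.I * b) ((1 + σ₂ / σ₁) / 2)
        (-((1 - σ₂ / σ₁) / 2)) x) := by
  have h0 : (σ₁ : ℂ) ≠ 0 := by exact_mod_cast hσ₁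
  have hI := Complex.I_sq
  rw [conductivity, transFld, transFld]
  split_ifs with h
  · push_cast
    simp only [map_mul, map_neg, Complex.conj_I]
    field_simp
    ring_nf
    rw [hI]
    ring
  · push_cast
    simp only [map_mul, map_neg, Complex.conj_I]
    simp only [div_eq_mul_inv]
    ring_nf
    rw [hI]
    ring

theorem transFld_conj_of_notMem {c : ℂ} {R : ℝ} (m : ℕ) (b : ℂ) (a d : ℝ) {z : ℂ}
    (hz : z ∉ Metric.ball c R) :
    transFld c R m (-Complex.I * b) a (-d) z = Complex.I * transFld c R m b a d z := by
  rw [transFld, transFld, if_neg hz, if_neg hz]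
  push_cast
  simp only [map_mul, map_neg, Complex.conj_I, div_eq_mul_inv]
  ring

/-- Green's formula for the transmission solution `w = transVal`: `∫ σ ∇u · ∇w` is the boundary
integral of `u` against `σ₁ ∂ₙ w`. -/
theorem HasTrace.integral_conductivity_transFld {u : ℂ → ℝ} {U : ℂ → ℂ} {f : Angles → ℝ}
    (h : HasTrace u U f) (hU : MemLp U 2 volΩ) (hf : MemLp f 2 arc) {c : ℂ} {R : ℝ} (hR : 0 < R)
    (hD : Metric.closedBall c R ⊆ Ω) {σ₁ : ℝ} (hσ₁ : σ₁ ≠ 0) (σ₂ : ℝ) (m : ℕ) (b : ℂ) :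
    ∫ x, conductivity σ₁ σ₂ (Metric.ball c R) x *
        inner ℝ (U x) (transFld c R m b ((1 + σ₂ / σ₁) / 2) ((1 - σ₂ / σ₁) / 2) x) ∂volΩ =
      σ₁ * ((2 * Real.pi) * ∫ θ, f θ * inner ℝ (transFld c R m b ((1 + σ₂ / σ₁) / 2)
        ((1 - σ₂ / σ₁) / 2) (bdryPoint θ)) (bdryPoint θ) ∂arc) := by
  have key := h.integral_inner_rot_transFld hU hf hR hD m (-Complex.I * b) ((1 + σ₂ / σ₁) / 2)
    (-((1 - σ₂ / σ₁) / 2))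
  have hnot : ∀ θ, bdryPoint θ ∉ Metric.ball c R := fun θ => by
    rw [mem_ball_iff_norm]
    exact (radius_lt_norm_bdryPoint_sub hR hD θ).not_gt
  have hinner : ∀ x y : ℂ, inner ℝ (Complex.I * x) (Complex.I * y) = inner ℝ x y := fun x y => by
    simp only [Complex.inner, Complex.mul_re, Complex.mul_im, Complex.conj_re, Complex.conj_im,
      Complex.I_re, Complex.I_im]
    ring
  simp only [transFld_conj_of_notMem _ _ _ _ (hnot _), hinner] at key
  rw [← key, ← integral_const_mul]
  refine integral_congr_ae (Eventually.of_forall fun x => ?_)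
  simp only
  rw [← real_inner_smul_right, ← real_inner_smul_right, Complex.real_smul, Complex.real_smul,
    conductivity_mul_transFld hσ₁]

/-! ### Boundary values -/

/-- The derivative `F'` on the circle of the Laurent polynomial `F` in `z - c` with
`Re F = transVal` outside the disk. -/
def outerDeriv (c : ℂ) (R : ℝ) (m : ℕ) (b : ℂ) (a d : ℝ) (z : ℂ) : ℂ :=
  (m + 1) * (a * (b * (z - c) ^ m) - d * (starRingEnd ℂ b * R ^ (2 * (m + 1)) / (z - c) ^ (m + 2)))

theorem inner_transFld_of_notMem {c : ℂ} {R : ℝ} (m : ℕ) (b : ℂ) (a d : ℝ) {z : ℂ}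
    (hz : z ∉ Metric.ball c R) (y : ℂ) :
    inner ℝ (transFld c R m b a d z) y = (outerDeriv c R m b a d z * y).re := by
  have h : starRingEnd ℂ (transFld c R m b a d z) = outerDeriv c R m b a d z := by
    rw [transFld, if_neg hz, outerDeriv]
    simp only [map_sub, map_mul, map_div₀, map_pow, map_add, map_one, map_natCast,
      Complex.conj_ofReal, Complex.conj_conj]
    ring
  rw [Complex.inner, h]
  ring_nf

theorem transVal_of_le {c : ℂ} {R : ℝ} (hR : 0 < R) (m : ℕ) (b : ℂ) (a d : ℝ) {z : ℂ}
    (hz : R ≤ ‖z - c‖) :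
    transVal c R m b a d z = (a * (b * (z - c) ^ (m + 1)) +
      d * (starRingEnd ℂ b * R ^ (2 * (m + 1)) * ((z - c)⁻¹) ^ (m + 1))).re := by
  have hpos : 0 < ‖z - c‖ := hR.trans_le hz
  have hζ : z - c ≠ 0 := norm_pos_iff.1 hpos
  set ζ := z - c with hζdef
  have hinv : ζ⁻¹ ^ (m + 1) =
      ((((‖ζ‖ ^ 2)⁻¹) ^ (m + 1) : ℝ) : ℂ) * starRingEnd ℂ (ζ ^ (m + 1)) := by
    rw [Complex.inv_def, Complex.normSq_eq_norm_sq, mul_pow, map_pow]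
    push_cast
    ring
  have e : (a * (b * ζ ^ (m + 1)) + d * (starRingEnd ℂ b * R ^ (2 * (m + 1)) * ζ⁻¹ ^ (m + 1)) : ℂ) =
      (a : ℂ) * (b * ζ ^ (m + 1)) + ((d * (R ^ 2 / ‖ζ‖ ^ 2) ^ (m + 1) : ℝ) : ℂ) *
        starRingEnd ℂ (b * ζ ^ (m + 1)) := by
    rw [hinv, map_mul]
    push_cast
    rw [div_eq_mul_inv, mul_pow, pow_mul]
    ring
  rw [transVal, ← hζdef, max_eq_left ((sq_le_sq₀ hR.le hpos.le).2 hz), e, Complex.add_re,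
    Complex.re_ofReal_mul, Complex.re_ofReal_mul, Complex.conj_re]
  ring

theorem hasDerivAt_bdryPoint (t : ℝ) :
    HasDerivAt (fun t : ℝ => bdryPoint (t : Angles)) (Complex.I * bdryPoint (t : Angles)) t := by
  simp only [bdryPoint_coe]
  have h := (((hasDerivAt_id t).ofReal_comp).mul_const Complex.I).cexp
  refine h.congr_deriv ?_
  simp [mul_comm]

theorem hasDerivAt_transVal_bdryPoint {c : ℂ} {R : ℝ} (hR : 0 < R)
    (hD : Metric.closedBall c R ⊆ Ω) (m : ℕ) (b : ℂ) (a d : ℝ) (t : ℝ) :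
    HasDerivAt (fun t : ℝ => transVal c R m b a d (bdryPoint (t : Angles)))
      (outerDeriv c R m b a d (bdryPoint (t : Angles)) *
        (Complex.I * bdryPoint (t : Angles))).re t := by
  simp only [transVal_of_le hR m b a d (radius_lt_norm_bdryPoint_sub hR hD _).le]
  have h0 : bdryPoint (t : Angles) - c ≠ 0 :=
    norm_pos_iff.1 (hR.trans (radius_lt_norm_bdryPoint_sub hR hD t))
  have h := (hasDerivAt_bdryPoint t).sub_const c
  have h1 := ((h.pow (m + 1)).const_mul b).const_mul (a : ℂ)
  have h2 := ((((h.inv h0).pow (m + 1)).const_mul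
    (starRingEnd ℂ b * R ^ (2 * (m + 1)))).const_mul (d : ℂ))
  have h3 := Complex.reCLM.hasFDerivAt.comp_hasDerivAt t (h1.add h2)
  refine h3.congr_deriv ?_
  simp only [Complex.reCLM_apply]
  congr 1
  rw [outerDeriv]
  simp only [Pi.inv_apply, inv_pow, Nat.add_sub_cancel, Nat.cast_add, Nat.cast_one]
  field_simp
  ring

theorem continuous_outerDeriv_bdryPoint {c : ℂ} {R : ℝ} (hR : 0 < R)
    (hD : Metric.closedBall c R ⊆ Ω) (m : ℕ) (b : ℂ) (a d : ℝ) :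
    Continuous fun θ => outerDeriv c R m b a d (bdryPoint θ) := by
  have h : Continuous fun θ => bdryPoint θ - c := continuous_bdryPoint.sub continuous_const
  unfold outerDeriv
  refine continuous_const.mul ((continuous_const.mul (continuous_const.mul (h.pow m))).sub
    (continuous_const.mul (continuous_const.div (h.pow _) fun θ => pow_ne_zero _ ?_)))
  exact norm_pos_iff.1 (hR.trans (radius_lt_norm_bdryPoint_sub hR hD θ))

/-! ### Calculus on the circle -/

theorem integral_mul_deriv_arc {A : Type*} [NormedRing A] [NormedAlgebra ℝ A] [CompleteSpace A]
    {g g' f f' : Angles → A} (hg' : Continuous g') (hf' : Continuous f')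
    (hg : ∀ t : ℝ, HasDerivAt (fun t : ℝ => g t) (g' t) t)
    (hf : ∀ t : ℝ, HasDerivAt (fun t : ℝ => f t) (f' t) t) :
    ∫ θ, g θ * f' θ ∂arc = -∫ θ, g' θ * f θ ∂arc := by
  have hc : Continuous fun t : ℝ => (t : Angles) := AddCircle.continuous_mk' _
  have h := intervalIntegral.integral_mul_deriv_eq_deriv_mul (a := 0) (b := 0 + 2 * Real.pi)
    (fun t _ => hg t) (fun t _ => hf t) ((hg'.comp hc).intervalIntegrable _ _)
    ((hf'.comp hc).intervalIntegrable _ _)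
  have hper : ((0 + 2 * Real.pi : ℝ) : Angles) = ((0 : ℝ) : Angles) := by
    rw [zero_add, AddCircle.coe_period]
    rfl
  rw [hper, sub_self, zero_sub, integral_arc (fun θ => g θ * f' θ),
    integral_arc (fun θ => g' θ * f θ), ← smul_neg] at h
  exact smul_right_injective A Real.two_pi_pos.ne' h

theorem mem_HHalf_of_hasDerivAt {f f' : Angles → ℝ} (hfc : Continuous f) (hf' : Continuous f')
    (hf : ∀ t : ℝ, HasDerivAt (fun t : ℝ => f t) (f' t) t) : f ∈ HHalf := by
  refine ⟨memLp_arc_of_continuous hfc, ?_⟩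
  have hcoeff : ∀ n : ℤ, coeff f' n = Complex.I * n * coeff f n := by
    intro n
    have hd : ∀ t : ℝ, HasDerivAt (fun t : ℝ => fourier (-n) (t : Angles))
        (-(Complex.I * n) * fourier (-n) (t : Angles)) t := by
      intro t
      refine (hasDerivAt_fourier_neg (2 * Real.pi) n t).congr_deriv ?_
      have hp : (Real.pi : ℂ) ≠ 0 := by exact_mod_cast Real.pi_ne_zero
      push_cast
      field_simp
    have h := integral_mul_deriv_arc (A := ℂ)
      (g' := fun θ => -(Complex.I * n) * fourier (-n) θ)
      (f := fun θ => (f θ : ℂ)) (f' := fun θ => (f' θ : ℂ))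
      (continuous_const.mul (fourier (-n)).continuous) (Complex.continuous_ofReal.comp hf')
      hd (fun t => (hf t).ofReal_comp)
    simp only [coeff, fourierCoeff, smul_eq_mul]
    rw [h, ← integral_const_mul, ← integral_neg]
    congr 1
    funext θ
    ring
  have hmem : MemLp (fun θ => (f' θ : ℂ)) 2 arc := (memLp_arc_of_continuous hf').ofReal
  have hsum := (hasSum_sq_fourierCoeff (hmem.toLp _)).summable
  refine Summable.of_nonneg_of_le (fun n => by positivity) (fun n => ?_) hsum
  have e : fourierCoeff (hmem.toLp _) n = coeff f' n := by
    refine integral_congr_ae ?_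
    filter_upwards [hmem.coeFn_toLp] with θ h
    rw [h]
  rw [e, hcoeff, norm_mul, norm_mul, Complex.norm_I, one_mul, mul_pow, Complex.norm_intCast,
    sq_abs]
  refine mul_le_mul_of_nonneg_right ?_ (sq_nonneg _)
  have h1 : |n| ≤ n ^ 2 := by
    rw [← sq_abs]
    exact Int.le_self_sq _
  exact_mod_cast h1

theorem cosFun_eq_re (θ : Angles) : cosFun θ = (bdryPoint θ).re := by
  induction θ using QuotientAddGroup.induction_on with
  | H t =>
    change Real.cos t = (bdryPoint (t : Angles)).re
    rw [bdryPoint_coe, Complex.exp_ofReal_mul_I_re]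

/-- The mean value property on the unit circle. -/
theorem integral_re_bdryPoint {H : ℂ → ℂ} (hH : DiffContOnCl ℂ H (Metric.ball 0 1)) :
    ∫ θ, (H (bdryPoint θ)).re ∂arc = (H 0).re := by
  have h := DiffContOnCl.circleAverage (f := H) (c := 0) (R := 1) (by simpa using hH)
  have hcont : Continuous fun θ => H (bdryPoint θ) := by
    have h1 : ContinuousOn H (Metric.closedBall 0 1) := hH.continuousOn_ball
    exact h1.comp_continuous continuous_bdryPoint fun θ => by simp [norm_bdryPoint]
  have hi : Integrable (fun θ => H (bdryPoint θ)) arc :=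
    hcont.integrable_of_hasCompactSupport (HasCompactSupport.of_compactSpace _)
  have h2 := integral_arc (fun θ => H (bdryPoint θ)) 0
  rw [zero_add] at h2
  rw [Real.circleAverage_def] at h
  simp only [circleMap_zero, Complex.ofReal_one, one_mul, ← bdryPoint_coe] at h
  rw [h2, smul_smul, inv_mul_cancel₀ Real.two_pi_pos.ne', one_smul] at h
  rw [← h]
  exact Complex.reCLM.integral_comp_comm hi

/-- On the circle, where `z̄ = z⁻¹`, the conjugate of the singular part of `F'` is the boundary
value of a function that is holomorphic in the unit disk. Conjugation does not change the real
part, so the mean value property applies. The signs `s = 1` and `s = -1` correspond to integrating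
`Re (z F')` against the cosine and `Re (i z F')` against minus the sine. -/
theorem integral_outerDeriv {c : ℂ} (hc : ‖c‖ < 1) (R : ℝ) (m : ℕ) (b : ℂ) (a d s : ℝ) :
    ∫ θ, ((1 + s * bdryPoint θ ^ 2) / 2 * outerDeriv c R m b a d (bdryPoint θ)).re ∂arc =
      (m + 1) / 2 * (a * (b * (-c) ^ m).re - s * d * b.re * R ^ (2 * (m + 1)) * 0 ^ m) := by
  set H : ℂ → ℂ := fun z => (m + 1) / 2 * (a * b * (1 + s * z ^ 2) * (z - c) ^ m -
    d * b * R ^ (2 * (m + 1)) * z ^ m * (z ^ 2 + s) / (1 - starRingEnd ℂ c * z) ^ (m + 2)) with hH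
  have hne : ∀ z ∈ Metric.closedBall (0 : ℂ) 1, 1 - starRingEnd ℂ c * z ≠ 0 := by
    intro z hz h0
    have h1 : ‖starRingEnd ℂ c * z‖ < 1 := by
      rw [norm_mul, RCLike.norm_conj]
      have : ‖z‖ ≤ 1 := by simpa using hz
      nlinarith [norm_nonneg c, norm_nonneg z]
    rw [← sub_eq_zero.1 h0, norm_one] at h1
    exact lt_irrefl _ h1
  have hdiff : DifferentiableOn ℂ H (Metric.closedBall 0 1) := by
    intro z hz
    refine DifferentiableAt.differentiableWithinAt ?_
    have := pow_ne_zero (m + 2) (hne z hz)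
    rw [hH]
    fun_prop (disch := assumption)
  have hcl : DiffContOnCl ℂ H (Metric.ball 0 1) :=
    DifferentiableOn.diffContOnCl (by rwa [closure_ball _ one_ne_zero])
  have h0 : (H 0).re =
      (m + 1) / 2 * (a * (b * (-c) ^ m).re - s * d * b.re * R ^ (2 * (m + 1)) * 0 ^ m) := by
    have e : H 0 = (((m + 1) / 2 : ℝ) : ℂ) * ((a : ℂ) * (b * (-c) ^ m) -
        ((s * d * R ^ (2 * (m + 1)) * 0 ^ m : ℝ) : ℂ) * b) := by
      simp only [hH]
      push_cast
      simp only [mul_zero, zero_pow two_ne_zero, zero_sub, sub_zero, one_pow, div_one, add_zero,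
        zero_add]
      ring
    rw [e, Complex.re_ofReal_mul, Complex.sub_re, Complex.re_ofReal_mul, Complex.re_ofReal_mul]
    ring
  rw [← h0, ← integral_re_bdryPoint hcl]
  congr 1
  funext θ
  have hz1 := norm_bdryPoint θ
  set z := bdryPoint θ with hz
  have hzz : z * starRingEnd ℂ z = 1 := by
    rw [Complex.mul_conj, Complex.normSq_eq_norm_sq, hz1]
    norm_num
  have hz0 : z ≠ 0 := left_ne_zero_of_mul_eq_one hzz
  have hzb : starRingEnd ℂ z = z⁻¹ := eq_inv_of_mul_eq_one_right hzz
  have hq := hne z (by simp [hz1])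
  set Q := 1 - starRingEnd ℂ c * z with hQ
  have e1 : (1 + s * z ^ 2) / 2 * outerDeriv c R m b a d z =
      (m + 1) / 2 * (a * b * (1 + s * z ^ 2) * (z - c) ^ m) -
      starRingEnd ℂ ((m + 1) / 2 * (d * b * R ^ (2 * (m + 1)) * z ^ m * (z ^ 2 + s) /
        Q ^ (m + 2))) := by
    have e3 : starRingEnd ℂ Q = z⁻¹ * (z - c) := by
      rw [hQ, map_sub, map_one, map_mul, Complex.conj_conj, hzb]
      field_simp
    have hζ0 : z - c ≠ 0 := fun h => by
      rw [h, mul_zero, map_eq_zero] at e3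
      exact hq e3
    rw [outerDeriv]
    simp only [map_mul, map_div₀, map_pow, map_add, map_one, map_natCast, Complex.conj_ofReal, hzb,
      e3, map_ofNat, mul_pow, inv_pow]
    field_simp
    ring
  rw [e1, Complex.sub_re, Complex.conj_re, ← Complex.sub_re]
  congr 1
  rw [hH]
  ring

/-! ### First Fourier coefficients of the transmission fields -/

theorem bdryPoint_notMem_ball {c : ℂ} {R : ℝ} (hR : 0 < R) (hD : Metric.closedBall c R ⊆ Ω)
    (θ : Angles) : bdryPoint θ ∉ Metric.ball c R := by
  rw [mem_ball_iff_norm]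
  exact (radius_lt_norm_bdryPoint_sub hR hD θ).not_gt

theorem bdryPoint_ne_zero (θ : Angles) : bdryPoint θ ≠ 0 := by
  rw [← norm_pos_iff, norm_bdryPoint]
  exact one_pos

theorem conj_bdryPoint (θ : Angles) : starRingEnd ℂ (bdryPoint θ) = (bdryPoint θ)⁻¹ := by
  rw [Complex.inv_def, Complex.normSq_eq_norm_sq, norm_bdryPoint]
  simp

theorem continuous_transVal (c : ℂ) {R : ℝ} (hR : 0 < R) (m : ℕ) (b : ℂ) (a d : ℝ) :
    Continuous (transVal c R m b a d) := by
  have h : ∀ z : ℂ, max (‖z - c‖ ^ 2) (R ^ 2) ≠ 0 := fun z =>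
    ((by positivity : 0 < R ^ 2).trans_le (le_max_right _ _)).ne'
  unfold transVal
  fun_prop (disch := exact h _)

theorem transVal_mem_HHalf {c : ℂ} {R : ℝ} (hR : 0 < R) (hD : Metric.closedBall c R ⊆ Ω)
    (m : ℕ) (b : ℂ) (a d : ℝ) : (fun θ => transVal c R m b a d (bdryPoint θ)) ∈ HHalf :=
  mem_HHalf_of_hasDerivAt ((continuous_transVal c hR m b a d).comp continuous_bdryPoint)
    (Complex.continuous_re.comp ((continuous_outerDeriv_bdryPoint hR hD m b a d).mul
      (continuous_const.mul continuous_bdryPoint)))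
    (hasDerivAt_transVal_bdryPoint hR hD m b a d)

/-- The first cosine coefficient of the normal derivative of `transVal`. -/
theorem integral_cos_mul_normalDeriv {c : ℂ} {R : ℝ} (hR : 0 < R)
    (hD : Metric.closedBall c R ⊆ Ω) (m : ℕ) (b : ℂ) (a d : ℝ) :
    ∫ θ, cosFun θ * inner ℝ (transFld c R m b a d (bdryPoint θ)) (bdryPoint θ) ∂arc =
      (m + 1) / 2 * (a * (b * (-c) ^ m).re - d * b.re * R ^ (2 * (m + 1)) * 0 ^ m) := by
  have hc : ‖c‖ < 1 := by linarith [norm_add_radius_lt_one hR hD]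
  have h := integral_outerDeriv hc R m b a d 1
  rw [one_mul] at h
  rw [← h]
  congr 1
  funext θ
  rw [inner_transFld_of_notMem m b a d (bdryPoint_notMem_ball hR hD θ), cosFun_eq_re,
    ← Complex.re_ofReal_mul, Complex.re_eq_add_conj, conj_bdryPoint]
  have h0 := bdryPoint_ne_zero θ
  congr 1
  push_cast
  field_simp
  ring

/-- The first cosine coefficient of the boundary values of `transVal`. -/
theorem integral_cos_mul_transVal {c : ℂ} {R : ℝ} (hR : 0 < R)
    (hD : Metric.closedBall c R ⊆ Ω) (m : ℕ) (b : ℂ) (a d : ℝ) :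
    ∫ θ, cosFun θ * transVal c R m b a d (bdryPoint θ) ∂arc =
      (m + 1) / 2 * (a * (b * (-c) ^ m).re + d * b.re * R ^ (2 * (m + 1)) * 0 ^ m) := by
  have hc : ‖c‖ < 1 := by linarith [norm_add_radius_lt_one hR hD]
  have h := integral_outerDeriv hc R m b a d (-1)
  have hsin : ∀ t : ℝ, HasDerivAt (fun t : ℝ => (bdryPoint (t : Angles)).im)
      (cosFun (t : Angles)) t := by
    intro t
    refine (Complex.imCLM.hasFDerivAt.comp_hasDerivAt t (hasDerivAt_bdryPoint t)).congr_deriv ?_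
    rw [cosFun_eq_re]
    simp
  have hibp := integral_mul_deriv_arc (g := fun θ => (bdryPoint θ).im) (g' := cosFun)
    (f := fun θ => transVal c R m b a d (bdryPoint θ))
    (f' := fun θ => (outerDeriv c R m b a d (bdryPoint θ) * (Complex.I * bdryPoint θ)).re)
    continuous_cosFun (Complex.continuous_re.comp
      ((continuous_outerDeriv_bdryPoint hR hD m b a d).mul
        (continuous_const.mul continuous_bdryPoint))) hsin
    (hasDerivAt_transVal_bdryPoint hR hD m b a d)
  rw [eq_neg_iff_add_eq_zero, add_comm, ← eq_neg_iff_add_eq_zero, ← integral_neg] at hibp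
  rw [hibp]
  refine Eq.trans ?_ (h.trans ?_)
  · congr 1
    funext θ
    have h0 := bdryPoint_ne_zero θ
    rw [← Complex.re_ofReal_mul, Complex.im_eq_sub_conj, conj_bdryPoint, ← Complex.neg_re]
    congr 1
    push_cast
    field_simp
    ring
  · ring

/-! ### Uniqueness of the weak solution -/

theorem tendsto_eLpNorm_smul_sub {α E : Type*} [MeasurableSpace α] {μ : Measure α}
    [NormedAddCommGroup E] [NormedSpace ℝ E] {A B : ℕ → α → E}
    (hA : ∀ k, AEStronglyMeasurable (A k) μ) (hB : ∀ k, AEStronglyMeasurable (B k) μ)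
    (hA0 : Tendsto (fun k => eLpNorm (A k) 2 μ) atTop (𝓝 0))
    (hB0 : Tendsto (fun k => eLpNorm (B k) 2 μ) atTop (𝓝 0)) (r : ℝ) :
    Tendsto (fun k => eLpNorm (r • A k - B k) 2 μ) atTop (𝓝 0) := by
  have h : Tendsto (fun k => ‖r‖ₑ * eLpNorm (A k) 2 μ + eLpNorm (B k) 2 μ) atTop (𝓝 0) := by
    simpa using (ENNReal.Tendsto.const_mul hA0 (Or.inr (enorm_ne_top (x := r)))).add hB0
  refine tendsto_of_tendsto_of_tendsto_of_le_of_le tendsto_const_nhds h (fun _ => zero_le)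
    fun k => ?_
  refine (eLpNorm_sub_le ((hA k).const_smul r) (hB k) (by norm_num)).trans_eq ?_
  rw [eLpNorm_const_smul]

theorem HasTrace.smul_sub {u u' : ℂ → ℝ} {G G' : ℂ → ℂ} {f f' : Angles → ℝ}
    (h : HasTrace u G f) (h' : HasTrace u' G' f') (hu : MemLp u 2 volΩ) (hu' : MemLp u' 2 volΩ)
    (hG : MemLp G 2 volΩ) (hG' : MemLp G' 2 volΩ) (hf : MemLp f 2 arc) (hf' : MemLp f' 2 arc)
    (r : ℝ) : HasTrace (r • u - u') (r • G - G') (r • f - f') := by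
  obtain ⟨v, hv, h1, h2, h3⟩ := h
  obtain ⟨v', hv', h1', h2', h3'⟩ := h'
  have hgrad : ∀ k x, gradient (r • v k - v' k) x = r • gradient (v k) x - gradient (v' k) x := by
    intro k x
    have hd := (hv k).differentiable (by simp) x
    have hd' := (hv' k).differentiable (by simp) x
    simp only [gradient]
    rw [fderiv_sub (hd.const_smul r) hd', fderiv_const_smul hd, map_sub]
    congr 1
    exact ext_inner_right ℝ fun y => by
      simp
  refine ⟨fun k => r • v k - v' k, fun k => ((hv k).const_smul r).sub (hv' k), ?_, ?_, ?_⟩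
  · refine (tendsto_eLpNorm_smul_sub (fun k => ?_) (fun k => ?_) h1 h1' r).congr fun k => ?_
    · exact (hv k).continuous.aestronglyMeasurable.sub hu.1
    · exact (hv' k).continuous.aestronglyMeasurable.sub hu'.1
    · congr 1
      funext x
      simp only [Pi.sub_apply, Pi.smul_apply, smul_eq_mul]
      ring
  · refine (tendsto_eLpNorm_smul_sub (fun k => ?_) (fun k => ?_) h2 h2' r).congr fun k => ?_
    · exact (continuous_gradient (hv k)).aestronglyMeasurable.sub hG.1
    · exact (continuous_gradient (hv' k)).aestronglyMeasurable.sub hG'.1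
    · congr 1
      funext x
      simp only [hgrad, Pi.sub_apply, Pi.smul_apply, Complex.real_smul]
      ring
  · refine (tendsto_eLpNorm_smul_sub (fun k => ?_) (fun k => ?_) h3 h3' r).congr fun k => ?_
    · exact ((hv k).continuous.comp continuous_bdryPoint).aestronglyMeasurable.sub hf.1
    · exact ((hv' k).continuous.comp continuous_bdryPoint).aestronglyMeasurable.sub hf'.1
    · congr 1
      funext x
      simp only [Pi.sub_apply, Pi.smul_apply, smul_eq_mul]
      ring

theorem integrable_conductivity_mul_inner (σ₁ σ₂ : ℝ) {D : Set ℂ} (hD : MeasurableSet D)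
    {G W : ℂ → ℂ} (hG : MemLp G 2 volΩ) (hW : MemLp W 2 volΩ) :
    Integrable (fun x => conductivity σ₁ σ₂ D x * inner ℝ (G x) (W x)) volΩ := by
  have hi : Integrable (fun x => inner ℝ (G x) (W x)) volΩ := by
    refine (L2.integrable_inner (𝕜 := ℝ) (hG.toLp G) (hW.toLp W)).congr ?_
    filter_upwards [hG.coeFn_toLp, hW.coeFn_toLp] with x h1 h2
    rw [h1, h2]
  refine hi.bdd_mul (c := |σ₁| + |σ₂ - σ₁|) ?_ (Eventually.of_forall fun x => ?_)
  · unfold conductivity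
    exact (measurable_const.add (measurable_const.mul
      (Measurable.ite hD measurable_const measurable_const))).aestronglyMeasurable
  · rw [conductivity, Real.norm_eq_abs]
    refine (abs_add_le _ _).trans (add_le_add_right ?_ _)
    split_ifs <;> simp

theorem conductivity_pos {σ₁ σ₂ : ℝ} (hσ₁ : 0 < σ₁) (hσ₂ : 0 < σ₂) (D : Set ℂ) (x : ℂ) :
    0 < conductivity σ₁ σ₂ D x := by
  rw [conductivity]
  split_ifs <;> linarith

/-- The normal derivative on `∂Ω` of the solution for a centred disk is a multiple of the cosine. -/
theorem inner_transFld_centred {R : ℝ} (hR : 0 < R) (hD : Metric.closedBall (0 : ℂ) R ⊆ Ω)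
    (a d : ℝ) (θ : Angles) :
    inner ℝ (transFld 0 R 0 1 a d (bdryPoint θ)) (bdryPoint θ) = (a - d * R ^ 2) * cosFun θ := by
  have h0 := bdryPoint_ne_zero θ
  rw [inner_transFld_of_notMem 0 1 a d (bdryPoint_notMem_ball hR hD θ), cosFun_eq_re]
  have e : outerDeriv 0 R 0 1 a d (bdryPoint θ) * bdryPoint θ =
      (a : ℂ) * bdryPoint θ - ((d * R ^ 2 : ℝ) : ℂ) * starRingEnd ℂ (bdryPoint θ) := by
    rw [conj_bdryPoint, outerDeriv]
    push_cast
    simp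
    field_simp
  rw [e, Complex.sub_re, Complex.re_ofReal_mul, Complex.re_ofReal_mul, Complex.conj_re]
  ring

theorem transVal_centred {R : ℝ} (hR : 0 < R) (hD : Metric.closedBall (0 : ℂ) R ⊆ Ω)
    (a d : ℝ) (θ : Angles) :
    transVal 0 R 0 1 a d (bdryPoint θ) = (a + d * R ^ 2) * cosFun θ := by
  rw [transVal_of_le hR 0 1 a d (radius_lt_norm_bdryPoint_sub hR hD θ).le, cosFun_eq_re]
  have e : ((a : ℂ) * (1 * (bdryPoint θ - 0) ^ (0 + 1)) + d * (starRingEnd ℂ 1 * R ^ (2 * (0 + 1)) *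
      (bdryPoint θ - 0)⁻¹ ^ (0 + 1)) : ℂ) =
      (a : ℂ) * bdryPoint θ + ((d * R ^ 2 : ℝ) : ℂ) * starRingEnd ℂ (bdryPoint θ) := by
    rw [conj_bdryPoint]
    push_cast
    simp
    ring
  rw [e, Complex.add_re, Complex.re_ofReal_mul, Complex.re_ofReal_mul, Complex.conj_re]
  ring

/-- Energy argument: the difference of a multiple of a weak solution and the explicit one has
trace zero, so it is orthogonal, with weight `σ`, to both gradients. -/
theorem ae_eq_transFld_centred {σ₁ σ₂ : ℝ} (hσ₁ : 0 < σ₁) (hσ₂ : 0 < σ₂) {R : ℝ} (hR : 0 < R)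
    (hD : Metric.closedBall (0 : ℂ) R ⊆ Ω) {u : ℂ → ℝ} {G : ℂ → ℂ} {g : HNegHalf}
    (hu : SolvesDirichlet σ₁ σ₂ (Metric.ball 0 R) cosData u G)
    (hg : HasFlux σ₁ σ₂ (Metric.ball 0 R) G g) :
    ∀ᵐ x ∂volΩ, ((1 + σ₂ / σ₁) / 2 + (1 - σ₂ / σ₁) / 2 * R ^ 2) • G x =
      transFld 0 R 0 1 ((1 + σ₂ / σ₁) / 2) ((1 - σ₂ / σ₁) / 2) x := by
  obtain ⟨⟨hu2, hG2, -⟩, htr, -⟩ := hu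
  set α := (1 + σ₂ / σ₁) / 2 with hα
  set β := (1 - σ₂ / σ₁) / 2 with hβ
  set V := transFld 0 R 0 1 α β with hV
  have hV2 : MemLp V 2 volΩ := memLp_transFld 0 hR 0 1 α β
  have htr' := hasTrace_transVal hR hD 0 1 α β
  have hf2 : MemLp (fun θ => transVal 0 R 0 1 α β (bdryPoint θ)) 2 arc :=
    (transVal_mem_HHalf hR hD 0 1 α β).1
  have htr0 := htr.smul_sub htr' hu2 (memLp_transVal 0 hR 0 1 α β) hG2 hV2 memLp_cosFun hf2
    (α + β * R ^ 2)
  set H : ℂ → ℂ := (α + β * R ^ 2) • G - V with hH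
  have hH2 : MemLp H 2 volΩ := (hG2.const_smul _).sub hV2
  have hzero : ((α + β * R ^ 2) • cosData.1 - fun θ => transVal 0 R 0 1 α β (bdryPoint θ)) =
      (0 : HHalf).1 := by
    funext θ
    simp only [Pi.sub_apply, Pi.smul_apply, transVal_centred hR hD, smul_eq_mul]
    exact sub_self _
  have hIsH1 := htr0.isH1 ((hu2.const_smul _).sub (memLp_transVal 0 hR 0 1 α β)) hH2
  rw [hzero] at htr0
  have e1 : ∫ x, conductivity σ₁ σ₂ (Metric.ball 0 R) x * inner ℝ (G x) (H x) ∂volΩ = 0 := by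
    rw [← hg 0 _ H hIsH1 htr0, map_zero]
  have e2 : ∫ x, conductivity σ₁ σ₂ (Metric.ball 0 R) x * inner ℝ (H x) (V x) ∂volΩ = 0 := by
    rw [htr0.integral_conductivity_transFld hH2 MemLp.zero hR hD hσ₁.ne' σ₂ 0 1]
    have : ∀ θ, (0 : HHalf).1 θ = 0 := fun _ => rfl
    simp [this]
  have hm : MeasurableSet (Metric.ball (0 : ℂ) R) := Metric.isOpen_ball.measurableSet
  have i1 := integrable_conductivity_mul_inner σ₁ σ₂ hm hG2 hH2
  have i2 := integrable_conductivity_mul_inner σ₁ σ₂ hm hH2 hV2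
  have e3 : ∀ x, (α + β * R ^ 2) *
      (conductivity σ₁ σ₂ (Metric.ball 0 R) x * inner ℝ (G x) (H x)) -
      conductivity σ₁ σ₂ (Metric.ball 0 R) x * inner ℝ (H x) (V x) =
      conductivity σ₁ σ₂ (Metric.ball 0 R) x * ‖H x‖ ^ 2 := by
    intro x
    have hx : H x = (α + β * R ^ 2) • G x - V x := rfl
    rw [← real_inner_self_eq_norm_sq]
    nth_rw 4 [hx]
    rw [inner_sub_right, real_inner_smul_right, real_inner_comm (G x) (H x)]
    ring
  have i3 := (i1.const_mul (α + β * R ^ 2)).sub i2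
  have e4 : ∫ x, conductivity σ₁ σ₂ (Metric.ball 0 R) x * ‖H x‖ ^ 2 ∂volΩ = 0 := by
    simp only [← e3]
    rw [integral_sub (i1.const_mul _) i2, integral_const_mul, e1, e2]
    ring
  have i4 : Integrable (fun x => conductivity σ₁ σ₂ (Metric.ball 0 R) x * ‖H x‖ ^ 2) volΩ :=
    i3.congr (Eventually.of_forall e3)
  have hpos := conductivity_pos hσ₁ hσ₂ (Metric.ball (0 : ℂ) R)
  have h0 := (integral_eq_zero_iff_of_nonneg
    (fun x => mul_nonneg (hpos x).le (sq_nonneg _)) i4).1 e4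
  filter_upwards [h0] with x hx
  have h1 : ‖H x‖ ^ 2 = 0 := (mul_eq_zero.1 hx).resolve_left (hpos x).ne'
  exact sub_eq_zero.1 (norm_eq_zero.1 (pow_eq_zero_iff two_ne_zero |>.1 h1))

/-! ### Comparison of the two disks -/

/-- The functional `Λ_D(cos)` of a centred disk is a multiple of the cosine. -/
theorem flux_centred {σ₁ σ₂ : ℝ} (hσ₁ : 0 < σ₁) (hσ₂ : 0 < σ₂) {R : ℝ} (hR : 0 < R)
    (hD : Metric.closedBall (0 : ℂ) R ⊆ Ω) {g : HNegHalf}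
    (hg : IsDirichletToNeumann σ₁ σ₂ (Metric.ball 0 R) cosData g) {w : ℂ → ℝ} {W : ℂ → ℂ}
    {φ : HHalf} (hw : IsH1 w W) (hφ : HasTrace w W φ.1) :
    ((1 + σ₂ / σ₁) / 2 + (1 - σ₂ / σ₁) / 2 * R ^ 2) * g.toLinearMap φ = σ₁ * (2 * Real.pi *
      (((1 + σ₂ / σ₁) / 2 - (1 - σ₂ / σ₁) / 2 * R ^ 2) * ∫ θ, cosFun θ * φ.1 θ ∂arc)) := by
  obtain ⟨u, G, hu, hflux⟩ := hg
  have hae := ae_eq_transFld_centred hσ₁ hσ₂ hR hD hu hflux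
  have key := hφ.integral_conductivity_transFld hw.2.1 φ.2.1 hR hD hσ₁.ne' σ₂ 0 1
  rw [hflux φ w W hw hφ, ← integral_const_mul]
  refine Eq.trans (integral_congr_ae ?_) (key.trans ?_)
  · filter_upwards [hae] with x hx
    rw [← hx, real_inner_smul_right, real_inner_comm]
    ring
  · congr 2
    rw [← integral_const_mul]
    congr 1
    funext θ
    rw [inner_transFld_centred hR hD]
    ring

/-- The symmetry of the Dirichlet-to-Neumann map, tested on the explicit solutions for the second
disk, leaves one scalar identity for each degree `m + 1` and each complex amplitude `b`. -/
theorem moment_identity {σ₁ σ₂ : ℝ} (hσ₁ : 0 < σ₁) (hσ₂ : 0 < σ₂) {R₁ : ℝ} (hR₁ : 0 < R₁)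
    (hD₁ : Metric.closedBall (0 : ℂ) R₁ ⊆ Ω) {c : ℂ} {R₂ : ℝ} (hR₂ : 0 < R₂)
    (hD₂ : Metric.closedBall c R₂ ⊆ Ω) {g : HNegHalf}
    (hg₁ : IsDirichletToNeumann σ₁ σ₂ (Metric.ball 0 R₁) cosData g)
    (hg₂ : IsDirichletToNeumann σ₁ σ₂ (Metric.ball c R₂) cosData g) (m : ℕ) (b : ℂ) :
    (1 - σ₂ / σ₁) * (1 + σ₂ / σ₁) * (R₁ ^ 2 * (b * (-c) ^ m).re) =
      (1 - σ₂ / σ₁) * (1 + σ₂ / σ₁) * (b.re * R₂ ^ (2 * (m + 1)) * 0 ^ m) := by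
  set α := (1 + σ₂ / σ₁) / 2 with hα
  set β := (1 - σ₂ / σ₁) / 2 with hβ
  have hw := isH1_transVal hR₂ hD₂ m b α β
  have htr := hasTrace_transVal hR₂ hD₂ m b α β
  have h1 := flux_centred hσ₁ hσ₂ hR₁ hD₁ hg₁ (φ := ⟨_, transVal_mem_HHalf hR₂ hD₂ m b α β⟩) hw htr
  obtain ⟨u, G, ⟨⟨-, hG, -⟩, hu, -⟩, hflux⟩ := hg₂
  rw [hflux ⟨_, transVal_mem_HHalf hR₂ hD₂ m b α β⟩ _ _ hw htr,
    hu.integral_conductivity_transFld hG memLp_cosFun hR₂ hD₂ hσ₁.ne' σ₂ m b] at h1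
  have h2 := integral_cos_mul_normalDeriv hR₂ hD₂ m b α β
  have h3 := integral_cos_mul_transVal hR₂ hD₂ m b α β
  change _ * (_ * (_ * ∫ θ, cosFun θ * _ ∂arc)) = _ at h1
  simp only [← hα, ← hβ] at h1
  rw [h2, h3] at h1
  have hne : σ₁ * (2 * Real.pi) * ((m + 1) / 2) ≠ 0 := by
    have := Real.pi_pos
    positivity
  have e1 : 1 - σ₂ / σ₁ = 2 * β := by rw [hβ]; ring
  have e2 : 1 + σ₂ / σ₁ = 2 * α := by rw [hα]; ring
  rw [e1, e2]
  refine mul_left_cancel₀ hne ?_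
  linear_combination 2 * h1

end DiskTomography

end

theorem theorem2p1 (σ₁ σ₂ : ℝ) (hσ₁ : 0 < σ₁) (hσ₂ : 0 < σ₂) (hσ : σ₁ ≠ σ₂)
    (R₁ : ℝ) (hR₁ : 0 < R₁) (hD₁ : Metric.closedBall (0 : ℂ) R₁ ⊆ DiskTomography.Ω)
    (c : ℂ) (R₂ : ℝ) (hR₂ : 0 < R₂) (hD₂ : Metric.closedBall c R₂ ⊆ DiskTomography.Ω)
    (g₁ g₂ : DiskTomography.HNegHalf)
    (hg₁ : DiskTomography.IsDirichletToNeumann σ₁ σ₂ (Metric.ball 0 R₁) DiskTomography.cosData g₁)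
    (hg₂ : DiskTomography.IsDirichletToNeumann σ₁ σ₂ (Metric.ball c R₂) DiskTomography.cosData g₂)
    (h : g₂ = g₁) :
    Metric.ball c R₂ = Metric.ball 0 R₁ := by
  subst h
  have hk : 0 < σ₂ / σ₁ := div_pos hσ₂ hσ₁
  have hne : (1 - σ₂ / σ₁) * (1 + σ₂ / σ₁) ≠ 0 := by
    refine mul_ne_zero (sub_ne_zero.2 fun h1 => hσ ?_) (by linarith)
    exact ((div_eq_one_iff_eq hσ₁.ne').1 h1.symm).symm
  have key := fun m b => mul_left_cancel₀ hne
    (DiskTomography.moment_identity hσ₁ hσ₂ hR₁ hD₁ hR₂ hD₂ hg₁ hg₂ m b)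
  -- Degree one compares the radii, degree two with amplitude `c̄` detects the centre.
  have hR : R₂ = R₁ := by
    have h0 := key 0 1
    simp only [pow_zero, mul_one, Complex.one_re, one_mul, zero_add] at h0
    exact ((sq_eq_sq₀ hR₁.le hR₂.le).1 h0).symm
  have hc : c = 0 := by
    have h1 := key 1 (starRingEnd ℂ c)
    have e : (starRingEnd ℂ c * (-c) ^ 1).re = -Complex.normSq c := by
      rw [pow_one, mul_neg, mul_comm, Complex.mul_conj, Complex.neg_re, Complex.ofReal_re]
    rw [e, zero_pow one_ne_zero, mul_zero] at h1
    have h2 := (mul_eq_zero.1 h1).resolve_left (pow_ne_zero 2 hR₁.ne')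
    exact Complex.normSq_eq_zero.1 (neg_eq_zero.1 h2)
  rw [hR, hc]
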